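/- Let $\Gamma$ be a hyperbolic group, let $S$ be a finite generating set of $\Gamma$, with Cayley graph $C_S(\Gamma)$ (edges $\{\gamma,\gamma s\}$, $s\in S$) and word metric $d_S$, and let $G=\mathrm{Isom}(X)$ be the isometry group, with the compact-open topology, of a proper, geodesic, Gromov-hyperbolic metric space $X$. Let $R(\Gamma,G)=\mathrm{Hom}(\Gamma,G)$, with the topology induced from $G^{S}$, and let $X(\Gamma,G)=R(\Gamma,G)/\mathrm{Inn}(G)$ be the space of conjugacy classes of representations, with the quotient topology. The group $\mathrm{Out}(\Gamma)=\mathrm{Aut}(\Gamma)/\mathrm{Inn}(\Gamma)$ acts on $X(\Gamma,G)$ by $[\varphi]\cdot[\rho]=[\rho\circ\varphi^{-1}]$. For $\gamma\in\Gamma$ let $l_S(\gamma)=\min_{g\in\Gamma}d_S(g,\gamma g)$; since $l_S$ is invariant under conjugation, $l_S(\phi(\gamma))$ is well defined for $\phi\in\mathrm{Out}(\Gamma)$. A subset $A\subset\Gamma$ is a *test subset* if for every sequence $(\phi_n)_{n}$ of pairwise distinct elements of $\mathrm{Out}(\Gamma)$ there is $a\in A$ with $\limsup_n l_S(\phi_n(a))=\infty$.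 For $a\in\Gamma$ of infinite order let $L_S(a)$ be the set of bi-infinite geodesics $l=(l_n)_{n\in\mathbb Z}$ of $C_S(\Gamma)$ (sequences in $\Gamma$ with $d_S(l_m,l_n)=|m-n|$ for all $m,n$) that join, in the Gromov boundary of $C_S(\Gamma)$, the repelling fixed point $a_-=\lim_{n\to\infty} a^{-n}$ to the attracting fixed point $a_+=\lim_{n\to\infty} a^{n}$. A representation $\rho\in R(\Gamma,G)$ is *$A$-stable* if there are $K\geq 1$, $C\geq 0$ and a point $x\in X$ such that, for every $a\in A$ of infinite order and every $l\in L_S(a)$, the orbit map sends $l$ to a $(K,C)$ quasi-geodesic of $X$, that is, $$\tfrac1K|m-n|-C\;\leq\; d\big(\rho(l_m)x,\rho(l_n)x\big)\;\leq\; K|m-n|+C\qquad\text{for all } m,n\in\mathbb Z .$$ Let $S_A(\Gamma,G)\subset X(\Gamma,G)$ be the set of conjugacy classes of $A$-stable representations. **Theorem.** If $A\subset\Gamma$ is $\mathrm{Aut}(\Gamma)$-invariant and is a test subset, then $S_A(\Gamma,G)$ is an open set of discontinuity for the action of $\mathrm{Out}(\Gamma)$ on $X(\Gamma,G)$: it is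 open in $X(\Gamma,G)$, it is $\mathrm{Out}(\Gamma)$-invariant, and $\mathrm{Out}(\Gamma)$ acts properly discontinuously on it, i.e. for every compact $R\subset S_A(\Gamma,G)$ the set $\{\phi\in\mathrm{Out}(\Gamma) : \phi(R)\cap R\neq\emptyset\}$ is finite. -/

import Mathlib

open Filter Topology

noncomputable section

namespace AStable

/-! ## Hyperbolic metric spaces -/

/-- The Gromov product `⟨x, y⟩_w` for a distance function `d`. -/
def gromovProduct {X : Type*} (d : X → X → ℝ) (w x y : X) : ℝ :=
  (d x w + d y w - d x y) / 2

/-- Gromov hyperbolicity (four point condition) of a distance function `d`. -/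
def IsGromovHyperbolic {X : Type*} (d : X → X → ℝ) : Prop :=
  ∃ δ : ℝ, 0 < δ ∧ ∀ w x y z : X,
    min (gromovProduct d w x y) (gromovProduct d w y z) - δ ≤ gromovProduct d w x z

/-- Any two points are joined by a geodesic segment. -/
def IsGeodesicSpace (X : Type*) [MetricSpace X] : Prop :=
  ∀ x y : X, ∃ f : ℝ → X, f 0 = x ∧ f (dist x y) = y ∧
    ∀ s ∈ Set.Icc 0 (dist x y), ∀ t ∈ Set.Icc 0 (dist x y), dist (f s) (f t) = |s - t|

/-- `f : ℤ → X` is a `(K, C)` quasi-geodesic, i.e. a `(K, C)` quasi-isometric embedding. -/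
def IsQuasiGeodesic {X : Type*} [MetricSpace X] (K C : ℝ) (f : ℤ → X) : Prop :=
  ∀ m n : ℤ, |(m : ℝ) - n| / K - C ≤ dist (f m) (f n) ∧
    dist (f m) (f n) ≤ K * |(m : ℝ) - n| + C

/-! ## Word metric, hyperbolic groups, geodesics of the Cayley graph -/

section Groups

variable {Γ : Type*} [Group Γ]

/-- The word metric `d_S`: the path distance between vertices of the Cayley graph. Its edges join
`γ` to `γ s` for `s ∈ S`, so that `Γ` acts on it by left multiplication. -/
def wordDist (S : Finset Γ) (g h : Γ) : ℕ :=
  (SimpleGraph.mulCayley (S : Set Γ)).dist g h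

/-- `Γ` is hyperbolic: for some finite generating set, the word metric is Gromov hyperbolic. -/
def IsHyperbolicGroup (Γ : Type*) [Group Γ] : Prop :=
  ∃ S : Finset Γ, Subgroup.closure (S : Set Γ) = ⊤ ∧
    IsGromovHyperbolic (fun g h : Γ => (wordDist S g h : ℝ))

/-- The translation length `l_S(γ)` for the action of `Γ` on its Cayley graph: the minimal
displacement of a vertex, which equals the minimal word length in the conjugacy class of `γ`. -/
def translationLength (S : Finset Γ) (γ : Γ) : ℕ :=
  ⨅ g : Γ, wordDist S g (γ * g)

/-- Two sequences of vertices converge to the same point of the Gromov boundary of the Cayley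
graph: `⟨u_i, v_j⟩_1 → ∞` as `i, j → ∞`. -/
def SameBoundaryPoint (S : Finset Γ) (u v : ℕ → Γ) : Prop :=
  Tendsto (fun p : ℕ × ℕ =>
      gromovProduct (fun g h : Γ => (wordDist S g h : ℝ)) 1 (u p.1) (v p.2))
    (atTop ×ˢ atTop) atTop

/-- `L_S(γ)`: the bi-infinite geodesics `l` of the Cayley graph, given by their sequence of
vertices, which join the repelling fixed point `γ₋ = lim γ⁻ⁿ` of `γ` to its attracting
fixed point `γ₊ = lim γⁿ`. -/
def axisGeodesics (S : Finset Γ) (γ : Γ) : Set (ℤ → Γ) :=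
  {l | (∀ m n : ℤ, (wordDist S (l m) (l n) : ℤ) = |m - n|) ∧
    SameBoundaryPoint S (fun n : ℕ => l n) (fun n : ℕ => γ ^ n) ∧
    SameBoundaryPoint S (fun n : ℕ => l (-n)) (fun n : ℕ => γ⁻¹ ^ n)}

/-- `L_S(A)`: the union of the sets `L_S(a)` over the elements `a ∈ A` of infinite order. -/
def geodesicsOf (S : Finset Γ) (A : Set Γ) : Set (ℤ → Γ) :=
  {l | ∃ a ∈ A, ¬ IsOfFinOrder a ∧ l ∈ axisGeodesics S a}

/-! ## Outer automorphisms and test subsets -/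

/-- The group of inner automorphisms. -/
def Inn (Γ : Type*) [Group Γ] : Subgroup (MulAut Γ) :=
  (MulAut.conj : Γ →* MulAut Γ).range

instance (Γ : Type*) [Group Γ] : (Inn Γ).Normal := by
  constructor
  rintro _ ⟨g, rfl⟩ φ
  refine ⟨φ g, ?_⟩
  ext x
  simp [MulAut.conj_apply]

/-- The group of outer automorphisms. -/
abbrev Out (Γ : Type*) [Group Γ] : Type _ := MulAut Γ ⧸ Inn Γ

theorem wordDist_mul_left (S : Finset Γ) (k g h : Γ) :
    wordDist S (k * g) (k * h) = wordDist S g h := by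
  have key : ∀ k g h : Γ, (SimpleGraph.mulCayley (S : Set Γ)).edist (k * g) (k * h) ≤
      (SimpleGraph.mulCayley (S : Set Γ)).edist g h := by
    intro k g h
    refine le_iInf fun p => ?_
    let f : SimpleGraph.mulCayley (S : Set Γ) →g SimpleGraph.mulCayley (S : Set Γ) :=
      ⟨fun x => k * x, fun {a b} hab => SimpleGraph.mulCayley_adj_mul_iff_right.2 hab⟩
    have := SimpleGraph.edist_le (p.map f)
    rwa [SimpleGraph.Walk.length_map] at this
  have h2 := key k⁻¹ (k * g) (k * h)
  rw [inv_mul_cancel_left, inv_mul_cancel_left] at h2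
  simp only [wordDist, SimpleGraph.dist]
  rw [le_antisymm (key k g h) h2]

theorem translationLength_conj (S : Finset Γ) (k γ : Γ) :
    translationLength S (k * γ * k⁻¹) = translationLength S γ := by
  unfold translationLength
  refine (Equiv.iInf_congr (Equiv.mulLeft k) fun g => ?_).symm
  have : k * γ * k⁻¹ * (Equiv.mulLeft k g) = k * (γ * g) := by
    simp [mul_assoc]
  rw [this]
  exact wordDist_mul_left S k g (γ * g)

/-- `l_S(φ(γ))` for an outer automorphism `φ`; it is well defined since `l_S` is invariant under
conjugation. -/
def outTranslationLength (S : Finset Γ) (φ : Out Γ) (γ : Γ) : ℕ :=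
  Quotient.liftOn' φ (fun ψ : MulAut Γ => translationLength S (ψ γ)) (by
    intro ψ₁ ψ₂ h
    obtain ⟨k, hk⟩ := QuotientGroup.leftRel_apply.1 h
    have h2 : ψ₂ = ψ₁ * MulAut.conj k := by rw [hk]; group
    change translationLength S (ψ₁ γ) = translationLength S (ψ₂ γ)
    rw [h2]
    simp only [MulAut.mul_apply, MulAut.conj_apply, map_mul, map_inv]
    exact (translationLength_conj S _ _).symm)

/-- `A` is invariant under all automorphisms of `Γ`. -/
def IsAutInvariant (A : Set Γ) : Prop :=
  ∀ φ : MulAut Γ, ∀ a ∈ A, φ a ∈ A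

/-- `A` is a test subset: for every sequence `φ_n` of distinct outer automorphisms there is `a ∈ A`
with `limsup l_S(φ_n(a)) = ∞`. -/
def IsTestSubset (S : Finset Γ) (A : Set Γ) : Prop :=
  ∀ φ : ℕ → Out Γ, Function.Injective φ →
    ∃ a ∈ A, limsup (fun n => (outTranslationLength S (φ n) a : ℕ∞)) atTop = ⊤

end Groups

/-! ## The space of representations -/

/-- The compact-open topology on the isometry group. -/
instance isomTopology (X : Type*) [MetricSpace X] : TopologicalSpace (X ≃ᵢ X) :=
  TopologicalSpace.induced (fun g => (⟨g, g.continuous⟩ : C(X, X))) ContinuousMap.compactOpen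

section Representations

variable {Γ : Type*} [Group Γ]

/-- The space of representations `R(Γ, G)`, `G = Isom(X)`. The generating set `S` only serves to
define the topology. -/
def RepSpace (_S : Finset Γ) (X : Type*) [MetricSpace X] : Type _ := Γ →* (X ≃ᵢ X)

/-- A point of the space of representations, as a homomorphism. -/
def RepSpace.hom {S : Finset Γ} {X : Type*} [MetricSpace X] (ρ : RepSpace S X) :
    Γ →* (X ≃ᵢ X) := ρ

variable (S : Finset Γ) (X : Type*) [MetricSpace X]

/-- `R(Γ, G)` has the topology of a subset of `G ^ S`. -/
instance : TopologicalSpace (RepSpace S X) :=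
  TopologicalSpace.induced (fun (ρ : RepSpace S X) (s : S) => ρ.hom s) Pi.topologicalSpace

/-- Two representations are equivalent when they are conjugate by an element of `G`. -/
def conjSetoid : Setoid (RepSpace S X) where
  r ρ σ := ∃ g : X ≃ᵢ X, ∀ γ : Γ, σ.hom γ =
    g * ρ.hom γ * g⁻¹
  iseqv :=
    { refl := fun ρ => ⟨1, fun γ => by simp⟩
      symm := by
        rintro ρ σ ⟨g, hg⟩
        refine ⟨g⁻¹, fun γ => ?_⟩
        rw [hg]; group
      trans := by
        rintro ρ σ τ ⟨g, hg⟩ ⟨h, hh⟩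
        refine ⟨h * g, fun γ => ?_⟩
        rw [hh, hg]; group }

/-- `X(Γ, G) = R(Γ, G) / Inn(G)`, the space of conjugacy classes of representations. -/
def CharSpace : Type _ := Quotient (conjSetoid S X)

/-- The quotient topology. -/
instance : TopologicalSpace (CharSpace S X) :=
  inferInstanceAs (TopologicalSpace (Quotient (conjSetoid S X)))

/-- The conjugacy class of a representation. -/
def conjClass (ρ : RepSpace S X) : CharSpace S X := Quotient.mk (conjSetoid S X) ρ

/-- `Aut(Γ)` acts on `R(Γ, G)` by `φ • ρ = ρ ∘ φ⁻¹`. -/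
instance : MulAction (MulAut Γ) (RepSpace S X) where
  smul φ ρ := (ρ.hom.comp (φ⁻¹ : MulAut Γ).toMonoidHom : Γ →* (X ≃ᵢ X))
  one_smul _ := rfl
  mul_smul φ ψ ρ := by
    apply MonoidHom.ext
    intro γ
    change ρ.hom ((φ * ψ)⁻¹ γ) =
      ρ.hom (ψ⁻¹ (φ⁻¹ γ))
    rw [mul_inv_rev]; rfl

/-- The induced action of `Aut(Γ)` on conjugacy classes. -/
instance : MulAction (MulAut Γ) (CharSpace S X) where
  smul φ := Quotient.map (sa := conjSetoid S X) (sb := conjSetoid S X) (fun ρ => φ • ρ) (by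
    rintro ρ σ ⟨g, hg⟩
    exact ⟨g, fun γ => hg (φ⁻¹ γ)⟩)
  one_smul := by
    rintro ⟨ρ⟩
    exact congrArg (conjClass S X) (one_smul (MulAut Γ) ρ)
  mul_smul φ ψ := by
    rintro ⟨ρ⟩
    exact congrArg (conjClass S X) (mul_smul φ ψ ρ)

theorem inn_smul (φ : MulAut Γ) (hφ : φ ∈ Inn Γ) (c : CharSpace S X) : φ • c = c := by
  obtain ⟨k, rfl⟩ := hφ
  obtain ⟨ρ⟩ := c
  refine Quotient.sound (s := conjSetoid S X) ?_
  refine ⟨RepSpace.hom ρ k, fun γ => ?_⟩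
  have h : RepSpace.hom (MulAut.conj k • ρ) γ = RepSpace.hom ρ (k⁻¹ * γ * k) := by
    change RepSpace.hom ρ ((MulAut.conj k)⁻¹ γ) = _
    rw [MulAut.conj_inv_apply]
  have h2 : RepSpace.hom ρ γ =
      RepSpace.hom ρ k * RepSpace.hom ρ (k⁻¹ * γ * k) * (RepSpace.hom ρ k)⁻¹ := by
    rw [← map_inv, ← map_mul, ← map_mul]
    congr 1
    group
  rw [← h] at h2
  exact h2

/-- `Inn(Γ)` acts trivially on conjugacy classes, whence an action of `Out(Γ)`. -/
instance : MulAction (Out Γ) (CharSpace S X) :=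
  MulAction.compHom (CharSpace S X)
    (QuotientGroup.lift (Inn Γ) (MulAction.toPermHom (MulAut Γ) (CharSpace S X))
      (fun φ hφ => Equiv.ext fun c => inn_smul S X φ hφ c))

/-- The action of the class of `φ` sends the class of `ρ` to the class of `ρ ∘ φ⁻¹`. -/
theorem out_smul_conjClass (φ : MulAut Γ) (ρ : RepSpace S X) :
    (QuotientGroup.mk φ : Out Γ) • conjClass S X ρ = conjClass S X (φ • ρ) := rfl

/-! ## Stable representations -/

variable {S X}

/-- The orbit map `γ ↦ ρ(γ) x`, on the vertices of the Cayley graph. -/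
def orbitMap (ρ : RepSpace S X) (x : X) (γ : Γ) : X :=
  ρ.hom γ x

/-- `ρ` is `(K, C)` `A`-stable: for some base point `x`, the orbit map sends every geodesic of
`L_S(A)` to a `(K, C)` quasi-geodesic. -/
def IsStableWith (A : Set Γ) (K C : ℝ) (ρ : RepSpace S X) : Prop :=
  ∃ x : X, ∀ l ∈ geodesicsOf S A, IsQuasiGeodesic K C (fun n : ℤ => orbitMap ρ x (l n))

/-- `ρ` is `A`-stable. -/
def IsStable (A : Set Γ) (ρ : RepSpace S X) : Prop :=
  ∃ K C : ℝ, 1 ≤ K ∧ 0 ≤ C ∧ IsStableWith A K C ρ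

variable (S X)

/-- `S_A(Γ, G)`: the set of conjugacy classes of `A`-stable representations. -/
def stableClasses (A : Set Γ) : Set (CharSpace S X) :=
  conjClass S X '' {ρ | IsStable A ρ}

end Representations

/-! ## Open sets of discontinuity -/

/-- `H` acts properly discontinuously on the subset `Y`. -/
def ActsProperlyDiscontinuouslyOn (H : Type*) {Z : Type*} [Group H] [TopologicalSpace Z]
    [MulAction H Z] (Y : Set Z) : Prop :=
  ∀ R : Set Z, R ⊆ Y → IsCompact R → {h : H | (((fun z => h • z) '' R) ∩ R).Nonempty}.Finite

/-- `Y` is an open set of discontinuity: it is open, `H`-invariant, and the action of `H` on it is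
properly discontinuous. -/
structure IsOpenSetOfDiscontinuity (H : Type*) {Z : Type*} [Group H] [TopologicalSpace Z]
    [MulAction H Z] (Y : Set Z) : Prop where
  isOpen : IsOpen Y
  smul_mem : ∀ h : H, ∀ y ∈ Y, h • y ∈ Y
  properlyDiscontinuous : ActsProperlyDiscontinuouslyOn H Y

end AStable

end

open AStable

/-! Stability is a condition on quasi-geodesics, and in a hyperbolic space these are rigid: they
fellow-travel geodesics (Morse lemma, `FourPoint.exists_gp_le_of_quasiGeodesic`), and being one can
be tested on windows of bounded length (`FourPoint.exists_isQuasiGeodesic_of_local`).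

Openness: for `l` in `L_S(A)`, the distance between `ρ(l_m)x` and `ρ(l_n)x` depends only on `(l_m)⁻¹
l_n`. The local test therefore involves only the finitely many elements of a ball of `Γ`. Their
displacements vary continuously with `ρ`, so nearby representations are stable with common constants
(`IsStable.exists_nhd`), and a compact set of stable classes admits uniform constants.

Invariance: an automorphism is a quasi-isometry of `Γ`, so it carries a geodesic of `L_S(a)` to
within bounded distance of one in `L_S(φ(a))`, with a bound independent of `a`
(`exists_axisGeodesic_near_map`).

Proper discontinuity: an element `b` of large translation length moves along an axis by about
`l_S(b)` per iteration. If `b ∈ A` and `ρ` is `(K, C)` stable, comparing the orbit of `b ^ k` with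
that axis and letting `k → ∞` gives `l_S(b) - 6δ ≤ K d(ρ(b)y, y)` for every `y`; the additive
constants disappear (`IsStableWith.le_dist`). If the class of `ρ` and its image under `φ` both lie
in a compact `R`, take `b = φ(a)`: since `(φ • ρ)(φ(a)) = ρ(a)` and the minimal displacement of
`ρ(a)` is bounded over `R`, so is `l_S(φ(a))`. Infinitely many such `φ` would contradict the test
property. -/

open Filter Topology

noncomputable section

namespace AStable

/-! ## Gromov products and rough geodesics -/

section Hyperbolic

variable {X : Type*} [MetricSpace X]

/-- The Gromov product for the distance of a metric space. -/
abbrev gp (w x y : X) : ℝ := gromovProduct dist w x y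

/-- The four point condition with constant `δ`. -/
def FourPoint (X : Type*) [MetricSpace X] (δ : ℝ) : Prop :=
  ∀ w x y z : X, min (gp w x y) (gp w y z) - δ ≤ gp w x z

/-- A finite chain of points which is a geodesic up to an additive error `1`. -/
def IsRoughGeodesic (g : ℕ → X) (n : ℕ) : Prop :=
  ∀ i ≤ n, ∀ j ≤ n, abs (dist (g i) (g j) - |(i : ℝ) - j|) ≤ 1

/-- Any two points are joined by a rough geodesic. -/
def IsRoughlyGeodesic (X : Type*) [MetricSpace X] : Prop :=
  ∀ x y : X, ∃ (n : ℕ) (g : ℕ → X), g 0 = x ∧ g n = y ∧ IsRoughGeodesic g n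

/-- `f` is a `(K, C)` quasi-geodesic on the integer interval `[a, b]`. -/
def IsQuasiGeodesicOn (K C : ℝ) (a b : ℤ) (f : ℤ → X) : Prop :=
  ∀ m ∈ Set.Icc a b, ∀ n ∈ Set.Icc a b, |(m : ℝ) - n| / K - C ≤ dist (f m) (f n) ∧
    dist (f m) (f n) ≤ K * |(m : ℝ) - n| + C

theorem gp_eq (w x y : X) : gp w x y = (dist x w + dist y w - dist x y) / 2 := rfl

theorem gp_comm (w x y : X) : gp w x y = gp w y x := by
  simp only [gp_eq, dist_comm x y]; ring

theorem gp_nonneg (w x y : X) : 0 ≤ gp w x y := by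
  rw [gp_eq]; linarith [dist_triangle_right x y w]

theorem gp_le_dist (w x y : X) : gp w x y ≤ dist x w := by
  rw [gp_eq]; linarith [dist_triangle y x w, dist_comm x y]

theorem gp_add_gp (x y z : X) : gp x y z + gp y x z = dist x y := by
  simp only [gp_eq]; rw [dist_comm y x, dist_comm z x, dist_comm z y]; ring

theorem gp_base_le (w w' x y : X) : gp w x y ≤ gp w' x y + dist w w' := by
  simp only [gp_eq]
  linarith [dist_triangle x w' w, dist_triangle y w' w, dist_comm w w']

theorem gp_right_le (w x y y' : X) : gp w x y ≤ gp w x y' + dist y y' := by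
  simp only [gp_eq]
  linarith [dist_triangle y y' w, dist_triangle x y y', dist_comm y y']

theorem gp_left_le (w x x' y : X) : gp w x y ≤ gp w x' y + dist x x' := by
  rw [gp_comm w x, gp_comm w x']; exact gp_right_le w y x x'

theorem FourPoint.le {δ t : ℝ} (h : FourPoint X δ) {w x y z : X} (h₁ : t ≤ gp w x y)
    (h₂ : t ≤ gp w y z) : t - δ ≤ gp w x z :=
  (sub_le_sub_right (le_min h₁ h₂) δ).trans (h w x y z)

/-- Halving the interval costs one `δ` per level, so the loss is logarithmic in the number of steps.
This is the exponential divergence behind the Morse lemma. -/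
theorem FourPoint.gp_chain {δ : ℝ} (hδ : 0 ≤ δ) (h : FourPoint X δ) (p : X) (x : ℤ → X) (t : ℝ)
    (k : ℕ) : ∀ a b : ℤ, a < b → b - a ≤ 2 ^ k →
      (∀ i, a ≤ i → i < b → t ≤ gp p (x i) (x (i + 1))) → t - k * δ ≤ gp p (x a) (x b) := by
  induction k with
  | zero =>
    intro a b hab hk hx
    obtain rfl : b = a + 1 := by rw [pow_zero] at hk; omega
    simpa using hx a le_rfl hab
  | succ k ih =>
    intro a b hab hk hx
    have h2 : (0 : ℤ) < 2 ^ k := by positivity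
    rw [pow_succ] at hk
    push_cast
    by_cases hs : b - a ≤ 2 ^ k
    · have := ih a b hab hs hx
      linarith
    · push Not at hs
      have h₁ := ih a (a + 2 ^ k) (by omega) (by omega) fun i hi hi' => hx i hi (by omega)
      have h₂ := ih (a + 2 ^ k) b (by omega) (by omega) fun i hi hi' => hx i (by omega) hi'
      have := h.le h₁ h₂
      linarith

/-- The hypothesis says that `R` is at most logarithmic in itself. Taking `k ≈ R / (2(δ + 1))`, the
exponential `2 ^ k` dominates `A * R + B` for large `R`, and the resulting inequality `R ≤ c + R /
2` forces `R ≤ 2 * c`. -/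
theorem exists_bound_of_exponential_growth {A B c δ : ℝ} (hA : 0 ≤ A) (hδ : 0 ≤ δ) :
    ∃ R₀ : ℝ, ∀ R : ℝ, 0 ≤ R → (∀ k : ℕ, A * R + B ≤ 2 ^ k → R ≤ c + k * δ) → R ≤ R₀ := by
  set e := δ + 1
  have he : 0 < e := by positivity
  have hlim : Tendsto (fun k : ℕ => A * (2 * e) * ((k : ℝ) ^ 1 / 2 ^ k) +
      (A * (2 * e) + B) * ((k : ℝ) ^ 0 / 2 ^ k)) atTop
      (𝓝 (A * (2 * e) * 0 + (A * (2 * e) + B) * 0)) :=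
    ((tendsto_pow_const_div_const_pow_of_one_lt 1 one_lt_two).const_mul _).add
      ((tendsto_pow_const_div_const_pow_of_one_lt 0 one_lt_two).const_mul _)
  have hev := hlim.eventually_le_const (u := 1) (by norm_num)
  obtain ⟨k₀, hk₀⟩ := eventually_atTop.1 hev
  refine ⟨max (2 * e * (k₀ + 1)) (2 * c), fun R hR h => ?_⟩
  by_contra! hlt
  obtain ⟨h₁, h₂⟩ := max_lt_iff.1 hlt
  set k := ⌊R / (2 * e)⌋₊
  have hkle : (k : ℝ) ≤ R / (2 * e) := Nat.floor_le (by positivity)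
  have hlek : R / (2 * e) < k + 1 := Nat.lt_floor_add_one _
  rw [le_div_iff₀ (by positivity)] at hkle
  rw [div_lt_iff₀ (by positivity)] at hlek
  have hk : k₀ ≤ k := by
    apply Nat.le_floor
    rw [le_div_iff₀ (by positivity)]
    nlinarith
  have hb := hk₀ k hk
  have h2k : (0 : ℝ) < 2 ^ k := by positivity
  have hb' : A * (2 * e) * (k + 1) + B ≤ 2 ^ k := by
    have : A * (2 * e) * ((k : ℝ) ^ 1 / 2 ^ k) + (A * (2 * e) + B) * ((k : ℝ) ^ 0 / 2 ^ k) =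
        (A * (2 * e) * (k + 1) + B) / 2 ^ k := by field_simp; ring
    rw [this, div_le_one h2k] at hb
    exact hb
  have := h k (by nlinarith [mul_le_mul_of_nonneg_left hlek.le hA])
  have hk0 : (0 : ℝ) ≤ k := by positivity
  have : (k : ℝ) * δ ≤ k * e := by gcongr; simp [e]
  nlinarith

/-- A chain with small backtracking makes linear progress. -/
theorem FourPoint.le_dist_of_chain {δ c ℓ : ℝ} (hδ : 0 ≤ δ) (h : FourPoint X δ)
    (hℓ : 2 * c + 2 * δ < ℓ) (x : ℕ → X)
    (hd : ∀ i, ℓ ≤ dist (x i) (x (i + 1))) (hc : ∀ i, gp (x (i + 1)) (x i) (x (i + 2)) ≤ c)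
    (n : ℕ) : n * (ℓ - 2 * c - 2 * δ) ≤ dist (x 0) (x n) := by
  -- The turn seen from the starting point `x 0` stays below `c + δ`. Seen from `x (n + 2)`, the
  -- points `x 0` and `x (n + 1)` have product at least `ℓ - (c + δ) > c + δ`; if `x 0` and `x (n +
  -- 3)` did too, the four point condition would make the local turn exceed `c`.
  have key : ∀ n, gp (x (n + 1)) (x 0) (x (n + 2)) ≤ c + δ := by
    intro n
    induction n with
    | zero => linarith [hc 0]
    | succ n ih =>
      have h₁ := gp_add_gp (x (n + 2)) (x (n + 1)) (x 0)
      rw [gp_comm (x (n + 1)), dist_comm] at h₁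
      have h₃ := hc (n + 1)
      have h₄ := hd (n + 1)
      by_contra! hlt
      have := h.le (w := x (n + 2)) (x := x (n + 1)) (y := x 0) (z := x (n + 3))
        (t := min (ℓ - (c + δ)) (gp (x (n + 2)) (x 0) (x (n + 3))))
        ((min_le_left _ _).trans (by linarith)) (min_le_right _ _)
      have h₅ : c + δ < min (ℓ - (c + δ)) (gp (x (n + 2)) (x 0) (x (n + 3))) :=
        lt_min (by linarith) hlt
      have h₆ : gp (x (n + 2)) (x (n + 1)) (x (n + 3)) ≤ c := h₃
      linarith
  induction n with
  | zero => simp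
  | succ n ih =>
    rcases n with _ | n
    · have h₁ := gp_nonneg (x 1) (x 0) (x 2)
      have h₂ := hc 0
      simp only [zero_add] at h₂ ⊢
      have := hd 0
      simp only [zero_add] at this
      push_cast
      linarith
    · have h₁ := key n
      rw [gp_eq] at h₁
      have := hd (n + 1)
      rw [dist_comm (x (n + 2))] at h₁
      push_cast at ih ⊢
      have h₂ : ℓ ≤ dist (x (n + 1)) (x (n + 2)) := this
      have h₃ : dist (x 0) (x (n + 1 + 1)) = dist (x 0) (x (n + 2)) := rfl
      rw [h₃]
      linarith

end Hyperbolic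

/-! ### Morse lemma for quasi-geodesics -/

section Hyperbolic

variable {X : Type*} [MetricSpace X]

theorem IsRoughGeodesic.dist_le {g : ℕ → X} {n : ℕ} (hg : IsRoughGeodesic g n) {i j : ℕ}
    (hij : i ≤ j) (hj : j ≤ n) : dist (g i) (g j) ≤ j - i + 1 := by
  have h := (abs_le.1 (hg i (hij.trans hj) j hj)).2
  have : (i : ℝ) ≤ j := by exact_mod_cast hij
  rw [abs_of_nonpos (by linarith)] at h
  linarith

theorem IsRoughGeodesic.le_dist {g : ℕ → X} {n : ℕ} (hg : IsRoughGeodesic g n) {i j : ℕ}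
    (hij : i ≤ j) (hj : j ≤ n) : (j : ℝ) - i - 1 ≤ dist (g i) (g j) := by
  have h := (abs_le.1 (hg i (hij.trans hj) j hj)).1
  have : (i : ℝ) ≤ j := by exact_mod_cast hij
  rw [abs_of_nonpos (by linarith)] at h
  linarith

theorem IsRoughGeodesic.gp_le {g : ℕ → X} {n : ℕ} (hg : IsRoughGeodesic g n) {i j k : ℕ}
    (hij : i ≤ j) (hjk : j ≤ k) (hk : k ≤ n) : gp (g j) (g i) (g k) ≤ 3 / 2 := by
  rw [gp_eq, dist_comm (g k)]
  have h₁ := hg.dist_le hij (hjk.trans hk)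
  have h₂ := hg.dist_le hjk hk
  have h₃ := hg.le_dist (hij.trans hjk) hk
  linarith

/-- A rough geodesic stays close to every quasi-geodesic with the same endpoints. -/
theorem FourPoint.exists_dist_le_of_quasiGeodesic {δ K C : ℝ} (hδ : 0 ≤ δ) (h : FourPoint X δ)
    (hK : 1 ≤ K) (hC : 0 ≤ C) :
    ∃ R₀ : ℝ, 0 ≤ R₀ ∧ ∀ (f : ℤ → X) (a b : ℤ) (g : ℕ → X) (n : ℕ), a ≤ b →
      IsQuasiGeodesicOn K C a b f → IsRoughGeodesic g n → g 0 = f a → g n = f b →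
      ∀ j ≤ n, ∃ m ∈ Set.Icc a b, dist (g j) (f m) ≤ R₀ := by
  -- With `R` the largest distance from the rough geodesic to `f`, the detour along `f` around the
  -- worst point has at most `K * (6 * R + 3 + C)` steps: its endpoints are within `R + (4 * R + 3)
  -- + R` of each other.
  obtain ⟨R₀, hR₀⟩ := exists_bound_of_exponential_growth (A := K * 6) (B := K * (3 + C))
    (c := 5 / 2 + (K + C) / 2 + 2 * δ) (by positivity) hδ
  refine ⟨max R₀ 0, le_max_right _ _, fun f a b g n hab hf hg h0 hn => ?_⟩
  have hmin : ∀ j, ∃ m ∈ Finset.Icc a b, ∀ m' ∈ Finset.Icc a b,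
      dist (g j) (f m) ≤ dist (g j) (f m') := fun j =>
    Finset.exists_min_image _ _ ⟨a, Finset.mem_Icc.2 ⟨le_rfl, hab⟩⟩
  choose near hnear hnear_le using hmin
  obtain ⟨j₀, hj₀, hmax⟩ := Finset.exists_max_image (Finset.range (n + 1))
    (fun j => dist (g j) (f (near j))) ⟨0, by simp⟩
  set R := dist (g j₀) (f (near j₀))
  have hRn : 0 ≤ R := dist_nonneg
  have hj₀n : j₀ ≤ n := Nat.lt_succ_iff.1 (Finset.mem_range.1 hj₀)
  have hfar : ∀ m ∈ Set.Icc a b, R ≤ dist (f m) (g j₀) := fun m hm => by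
    rw [dist_comm]; exact hnear_le j₀ m (Finset.mem_Icc.2 hm)
  have hclose : ∀ j ≤ n, dist (g j) (f (near j)) ≤ R := fun j hj =>
    hmax j (Finset.mem_range.2 (by omega))
  suffices hs : R ≤ R₀ from fun j hj =>
    ⟨near j, Finset.mem_Icc.1 (hnear j), ((hclose j hj).trans hs).trans (le_max_left _ _)⟩
  refine hR₀ R hRn fun k hk => ?_
  -- Moving about `2 * R` away from the worst point leaves room to jump to `f` without coming near
  -- that point; an endpoint of `g` already lies on `f`.
  have hside : ∀ j ≤ n, (j = 0 ∨ j = n ∨ 2 * R - 1 ≤ dist (g j) (g j₀)) →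
      ∃ s ∈ Set.Icc a b, dist (g j) (f s) ≤ R ∧ R - 1 ≤ gp (g j₀) (g j) (f s) := by
    have hend : ∀ s ∈ Set.Icc a b, dist (f s) (f s) ≤ R ∧ R - 1 ≤ gp (g j₀) (f s) (f s) := by
      intro s hs
      have := hfar s hs
      rw [gp_eq, dist_self]
      constructor <;> linarith
    rintro j hj (rfl | rfl | hd)
    · rw [h0]; exact ⟨a, ⟨le_rfl, hab⟩, hend a ⟨le_rfl, hab⟩⟩
    · rw [hn]; exact ⟨b, ⟨hab, le_rfl⟩, hend b ⟨hab, le_rfl⟩⟩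
    · have hm := Finset.mem_Icc.1 (hnear j)
      refine ⟨near j, hm, hclose j hj, ?_⟩
      have := hfar _ hm
      have := hclose j hj
      rw [gp_eq]; linarith
  -- Every point of `f` is at distance at least `R` from `g j₀` and its steps have length at most `K
  -- + C`, so consecutive points have product at least `R - (K + C) / 2`.
  have hlog : ∀ s ∈ Set.Icc a b, ∀ t ∈ Set.Icc a b, s < t → t - s ≤ 2 ^ k →
      R - (K + C) / 2 - k * δ ≤ gp (g j₀) (f s) (f t) := by
    intro s hs t ht hst hkst
    refine h.gp_chain hδ (g j₀) f _ k s t hst hkst fun i hi hi' => ?_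
    have hi₁ : i ∈ Set.Icc a b := ⟨hs.1.trans hi, hi'.le.trans ht.2⟩
    have hi₂ : i + 1 ∈ Set.Icc a b := ⟨by linarith [hi₁.1], by linarith [ht.2]⟩
    have h₁ := hfar _ hi₁
    have h₂ := hfar _ hi₂
    have h₃ := (hf i hi₁ (i + 1) hi₂).2
    push_cast at h₃
    rw [show (i : ℝ) - (i + 1) = -1 by ring, abs_neg, abs_one] at h₃
    rw [gp_eq]; linarith
  have hlog' : ∀ s ∈ Set.Icc a b, ∀ t ∈ Set.Icc a b, |(s : ℝ) - t| ≤ 2 ^ k →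
      R - (K + C) / 2 - k * δ ≤ gp (g j₀) (f s) (f t) := by
    intro s hs t ht hst
    have hkδ : 0 ≤ k * δ := by positivity
    have hst' : |s - t| ≤ 2 ^ k := by exact_mod_cast hst
    rw [abs_le] at hst'
    rcases lt_trichotomy s t with hlt | rfl | hlt
    · exact hlog s hs t ht hlt (by omega)
    · have := hfar s hs
      rw [gp_eq, dist_self]; linarith
    · rw [gp_comm]; exact hlog t ht s hs hlt (by omega)
  have hceil : 2 * R ≤ ⌈2 * R⌉₊ := Nat.le_ceil _
  have hceil' : (⌈2 * R⌉₊ : ℝ) < 2 * R + 1 := Nat.ceil_lt_add_one (by linarith)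
  set q := ⌈2 * R⌉₊
  obtain ⟨s, hs, hus, hgs⟩ := hside (j₀ - q) (by omega) (by
    by_cases hq : j₀ ≤ q
    · left; omega
    · right; right
      have := hg.le_dist (Nat.sub_le j₀ q) hj₀n
      rw [Nat.cast_sub (by omega)] at this
      linarith)
  obtain ⟨t, ht, hvt, hgt⟩ := hside (min (j₀ + q) n) (min_le_right _ _) (by
    by_cases hq : j₀ + q ≤ n
    · right; right
      rw [min_eq_left hq]
      have := hg.le_dist (Nat.le_add_right j₀ q) hq
      rw [dist_comm]
      push_cast at this
      linarith
    · right; left; omega)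
  have huv : dist (g (j₀ - q)) (g (min (j₀ + q) n)) ≤ 4 * R + 3 := by
    refine (hg.dist_le (by omega) (min_le_right _ _)).trans ?_
    have h₁ : ((min (j₀ + q) n : ℕ) : ℝ) ≤ j₀ + q := by exact_mod_cast min_le_left _ _
    have h₂ : (j₀ : ℝ) ≤ (j₀ - q : ℕ) + q := by
      exact_mod_cast (by omega : j₀ ≤ (j₀ - q) + q)
    linarith
  have hst : |(s : ℝ) - t| ≤ 2 ^ k := by
    refine le_trans ?_ hk
    have h₁ := (hf s hs t ht).1
    have h₂ : dist (f s) (f t) ≤ 6 * R + 3 := by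
      linarith [dist_triangle4 (f s) (g (j₀ - q)) (g (min (j₀ + q) n)) (f t),
        dist_comm (f s) (g (j₀ - q))]
    have h₃ : |(s : ℝ) - t| / K ≤ 6 * R + 3 + C := by linarith
    rw [div_le_iff₀ (by linarith)] at h₃
    linarith
  have hmid := hlog' s hs t ht hst
  have hkδ : 0 ≤ k * δ := by positivity
  have h₁ := h.le (t := R - 1 - (K + C) / 2 - k * δ) (w := g j₀) (x := g (j₀ - q)) (y := f s)
    (z := f t) (by linarith) (by linarith)
  have h₂ := h.le (t := R - 1 - (K + C) / 2 - k * δ - δ) (w := g j₀) (x := g (j₀ - q)) (y := f t)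
    (z := g (min (j₀ + q) n)) (by linarith) (by rw [gp_comm]; linarith)
  have h₃ := hg.gp_le (i := j₀ - q) (j := j₀) (k := min (j₀ + q) n) (by omega) (by omega)
    (by omega)
  linarith

/-- Points of a quasi-geodesic lie coarsely between its endpoints (Morse lemma). -/
theorem FourPoint.exists_gp_le_of_quasiGeodesic {δ K C : ℝ} (hδ : 0 ≤ δ) (h : FourPoint X δ)
    (hX : IsRoughlyGeodesic X) (hK : 1 ≤ K) (hC : 0 ≤ C) :
    ∃ D : ℝ, 0 ≤ D ∧ ∀ (f : ℤ → X) (a b : ℤ), IsQuasiGeodesicOn K C a b f →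
      ∀ i ∈ Set.Icc a b, gp (f i) (f a) (f b) ≤ D := by
  obtain ⟨R, hR, hnear⟩ := h.exists_dist_le_of_quasiGeodesic hδ hK hC
  refine ⟨3 / 2 + (K * (K * (2 * R + 2 + C)) + C + R), by positivity, fun f a b hf i hi => ?_⟩
  have hab : a ≤ b := hi.1.trans hi.2
  obtain ⟨n, g, h0, hn, hg⟩ := hX (f a) (f b)
  have hnear := hnear f a b g n hab hf hg h0 hn
  obtain ⟨j, hj, s, hs, hsi, hds, t, ht, hit, hst⟩ : ∃ j ≤ n, ∃ s ∈ Set.Icc a b, s ≤ i ∧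
      dist (g j) (f s) ≤ R ∧ ∃ t ∈ Set.Icc a b, i ≤ t ∧ dist (f s) (f t) ≤ 2 * R + 2 := by
    classical
    -- A discrete connectedness argument: the last point of `g` close to the part of `f` before `i`
    -- is followed by a point close to the part after `i` (or is the endpoint `f b`). The parameters
    -- `s ≤ i ≤ t` then have close images, so they are close to each other and to `i`.
    let P : ℕ → Prop := fun j => ∃ s ∈ Set.Icc a b, s ≤ i ∧ dist (g j) (f s) ≤ R
    have hP0 : P 0 := ⟨a, ⟨le_rfl, hab⟩, hi.1, by rw [h0, dist_self]; exact hR⟩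
    have hle : Nat.findGreatest P n ≤ n := Nat.findGreatest_le n
    obtain ⟨s, hs, hsi, hds⟩ : P (Nat.findGreatest P n) :=
      Nat.findGreatest_spec (Nat.zero_le n) hP0
    refine ⟨_, hle, s, hs, hsi, hds, ?_⟩
    rcases hle.eq_or_lt with heq | hlt
    · refine ⟨b, ⟨hab, le_rfl⟩, hi.2, ?_⟩
      rw [heq, hn, dist_comm] at hds
      linarith
    · obtain ⟨t, ht, hdt⟩ := hnear (Nat.findGreatest P n + 1) hlt
      have hnot : ¬ P (Nat.findGreatest P n + 1) :=
        Nat.findGreatest_is_greatest (Nat.lt_succ_self _) hlt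
      refine ⟨t, ht, ?_, ?_⟩
      · by_contra! hti
        exact hnot ⟨t, ht, hti.le, hdt⟩
      · have h₁ := hg.dist_le (Nat.le_succ (Nat.findGreatest P n)) hlt
        rw [Nat.succ_eq_add_one] at h₁
        push_cast at h₁
        linarith [dist_triangle4 (f s) (g (Nat.findGreatest P n)) (g (Nat.findGreatest P n + 1))
          (f t), dist_comm (f s) (g (Nat.findGreatest P n))]
  have hK0 : 0 < K := by linarith
  have hsi' : (s : ℝ) ≤ i := by exact_mod_cast hsi
  have hit' : (i : ℝ) ≤ t := by exact_mod_cast hit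
  have h₁ : (i : ℝ) - s ≤ K * (2 * R + 2 + C) := by
    have h₂ := (hf s hs t ht).1
    rw [abs_of_nonpos (by linarith)] at h₂
    have h₃ : -((s : ℝ) - t) / K ≤ 2 * R + 2 + C := by linarith
    rw [div_le_iff₀ hK0] at h₃
    linarith
  have h₂ := (hf i hi s hs).2
  rw [abs_of_nonneg (by linarith)] at h₂
  have h₃ : K * ((i : ℝ) - s) ≤ K * (K * (2 * R + 2 + C)) := by gcongr
  have h₄ := gp_base_le (f i) (g j) (f a) (f b)
  have h₅ := hg.gp_le (Nat.zero_le j) hj le_rfl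
  rw [h0, hn] at h₅
  linarith [dist_triangle (f i) (f s) (g j), dist_comm (f s) (g j)]

end Hyperbolic

/-! ### Local-to-global principle and coarsely straight chains -/

section Hyperbolic

variable {X : Type*} [MetricSpace X]

/-- A geodesic is sampled at integer times. Only the last time may be clipped to `dist x y`, by less
than `1`, which accounts for the additive error. -/
theorem IsGeodesicSpace.isRoughlyGeodesic (hX : IsGeodesicSpace X) : IsRoughlyGeodesic X := by
  intro x y
  obtain ⟨f, h0, h1, hf⟩ := hX x y
  have hd : 0 ≤ dist x y := dist_nonneg
  refine ⟨⌈dist x y⌉₊, fun i => f (min i (dist x y)), ?_, ?_, fun i hi j hj => ?_⟩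
  · simpa [min_eq_left hd] using h0
  · simpa [min_eq_right (Nat.le_ceil (dist x y))] using h1
  · have hlt := Nat.ceil_lt_add_one hd
    have hi' : (i : ℝ) ≤ ⌈dist x y⌉₊ := by exact_mod_cast hi
    have hj' : (j : ℝ) ≤ ⌈dist x y⌉₊ := by exact_mod_cast hj
    rw [hf _ ⟨le_min (by positivity) hd, min_le_right _ _⟩ _
      ⟨le_min (by positivity) hd, min_le_right _ _⟩]
    refine (abs_abs_sub_abs_le_abs_sub _ _).trans (abs_le.2 ?_)
    have hmin : ∀ k : ℕ, (k : ℝ) ≤ ⌈dist x y⌉₊ →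
        min (k : ℝ) (dist x y) ≤ k ∧ (k : ℝ) - 1 ≤ min (k : ℝ) (dist x y) := fun k hk =>
      ⟨min_le_left _ _, le_min (by linarith) (by linarith)⟩
    have hi₂ := hmin i hi'
    have hj₂ := hmin j hj'
    constructor <;> linarith [hi₂.1, hi₂.2, hj₂.1, hj₂.2]

/-- Local quasi-geodesics are quasi-geodesics. -/
theorem FourPoint.exists_isQuasiGeodesic_of_local {δ K C : ℝ} (hδ : 0 ≤ δ) (h : FourPoint X δ)
    (hX : IsRoughlyGeodesic X) (hK : 1 ≤ K) (hC : 0 ≤ C) :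
    ∃ (L : ℕ) (K' C' : ℝ), 1 ≤ K' ∧ 0 ≤ C' ∧ ∀ f : ℤ → X,
      (∀ m n : ℤ, |m - n| ≤ L → |(m : ℝ) - n| / K - C ≤ dist (f m) (f n) ∧
        dist (f m) (f n) ≤ K * |(m : ℝ) - n| + C) → IsQuasiGeodesic K' C' f := by
  obtain ⟨D, hD, hM⟩ := h.exists_gp_le_of_quasiGeodesic hδ hX hK hC
  have hK0 : 0 < K := by linarith
  -- `M` is chosen so that points of `f` at parameter distance `M` are at least `2 * D + 2 * δ + 1`
  -- apart. Windows of length `2 * M` contain two consecutive steps of this size, and the Morse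
  -- lemma bounds the turn between them by `D`; the chain then gains at least `1` per `M`
  -- parameters.
  set M := ⌈K * (2 * D + 2 * δ + 1 + C)⌉₊
  have hMge : K * (2 * D + 2 * δ + 1 + C) ≤ M := Nat.le_ceil _
  have hM1 : (1 : ℝ) ≤ M := by nlinarith
  have hM1' : 1 ≤ M := by exact_mod_cast hM1
  have hMK : 2 * D + 2 * δ + 1 ≤ M / K - C := by
    have : 2 * D + 2 * δ + 1 + C ≤ M / K := by rw [le_div_iff₀ hK0]; linarith
    linarith
  refine ⟨2 * M, max (M : ℝ) (K + C), 1 + K * M + C, hM1.trans (le_max_left _ _), by positivity,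
    fun f hf => ?_⟩
  have hstep : ∀ (m : ℤ) (k : ℕ), dist (f m) (f (m + k)) ≤ (K + C) * k := by
    intro m k
    induction k with
    | zero => simp
    | succ k ih =>
      have h₁ := (hf (m + k) (m + (k + 1 : ℕ)) (by
        rw [abs_le]; push_cast; constructor <;> omega)).2
      push_cast at h₁ ih ⊢
      rw [show (m : ℝ) + k - (m + (k + 1)) = -1 by ring, abs_neg, abs_one] at h₁
      linarith [dist_triangle (f m) (f (m + k)) (f (m + (k + 1)))]
  have hlower : ∀ (m : ℤ) (k : ℕ), (k : ℝ) / M - (1 + K * M + C) ≤ dist (f m) (f (m + k)) := by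
    intro m k
    obtain ⟨q, r, rfl, hr⟩ : ∃ q r : ℕ, k = q * M + r ∧ r < M :=
      ⟨k / M, k % M, (Nat.div_add_mod' k M).symm, Nat.mod_lt k hM1'⟩
    have hchain := h.le_dist_of_chain (c := D) (ℓ := 2 * D + 2 * δ + 1) hδ (by linarith)
      (fun i => f (m + i * M)) (fun i => by
        have h₁ := (hf (m + i * M) (m + (i + 1 : ℕ) * M) (by
          rw [abs_le]; push_cast; constructor <;> linarith)).1
        push_cast at h₁ ⊢
        rw [show (m : ℝ) + i * M - (m + (i + 1) * M) = -M by ring, abs_neg,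
          abs_of_nonneg (by positivity)] at h₁
        linarith) (fun i => by
        refine hM f (m + i * M) (m + (i + 2 : ℕ) * M) (fun s hs t ht => hf s t ?_) _ ?_
        · have h₁ := hs.1
          have h₂ := hs.2
          have h₃ := ht.1
          have h₄ := ht.2
          push_cast at *
          rw [abs_le]
          constructor <;> linarith
        · push_cast
          constructor <;> linarith) q
    have hrem := (hf (m + q * M) (m + (q * M + r : ℕ)) (by
      rw [abs_le]
      push_cast
      constructor <;> omega)).2
    push_cast at hrem hchain ⊢
    rw [show (m : ℝ) + q * M - (m + (q * M + r)) = -r by ring, abs_neg,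
      abs_of_nonneg (by positivity)] at hrem
    have hr' : (r : ℝ) ≤ M := by exact_mod_cast hr.le
    have hdiv : ((q : ℝ) * M + r) / M ≤ q + 1 := by
      rw [div_le_iff₀ (by linarith)]
      linarith
    have h₂ : K * (r : ℝ) ≤ K * M := by gcongr
    simp only [zero_mul, add_zero] at hchain
    rw [show (q : ℝ) * (2 * D + 2 * δ + 1 - 2 * D - 2 * δ) = q by ring] at hchain
    linarith [dist_triangle (f m) (f (m + (q * M + r))) (f (m + q * M)),
      dist_comm (f (m + (q * M + r))) (f (m + q * M))]
  have main : ∀ (m : ℤ) (k : ℕ), (k : ℝ) / max (M : ℝ) (K + C) - (1 + K * M + C) ≤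
      dist (f m) (f (m + k)) ∧ dist (f m) (f (m + k)) ≤ max (M : ℝ) (K + C) * k + (1 + K * M + C) := by
    intro m k
    constructor
    · refine le_trans ?_ (hlower m k)
      gcongr
      exact le_max_left _ _
    · refine (hstep m k).trans ?_
      have : (K + C) * (k : ℝ) ≤ max (M : ℝ) (K + C) * k := by gcongr; exact le_max_right _ _
      have : 0 ≤ 1 + K * M + C := by positivity
      linarith
  intro m n
  rcases le_total m n with hmn | hmn
  · obtain ⟨k, rfl⟩ := Int.le.dest hmn
    have := main m k
    push_cast
    rwa [show (m : ℝ) - (m + k) = -k by ring, abs_neg, abs_of_nonneg (by positivity)]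
  · obtain ⟨k, rfl⟩ := Int.le.dest hmn
    have := main n k
    push_cast
    rwa [dist_comm, show (n : ℝ) + k - n = k by ring, abs_of_nonneg (by positivity)]

/-- A discrete intermediate value theorem for the distance to the starting point. -/
theorem exists_dist_mem_Icc {g : ℕ → X} {n : ℕ} {s t : ℝ} (hs : 0 ≤ s)
    (hstep : ∀ j < n, dist (g j) (g (j + 1)) ≤ s) (h0 : 0 ≤ t) (ht : t ≤ dist (g 0) (g n)) :
    ∃ j ≤ n, t - s ≤ dist (g 0) (g j) ∧ dist (g 0) (g j) ≤ t := by
  classical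
  have hle : Nat.findGreatest (fun j => dist (g 0) (g j) ≤ t) n ≤ n := Nat.findGreatest_le n
  have hP : dist (g 0) (g (Nat.findGreatest (fun j => dist (g 0) (g j) ≤ t) n)) ≤ t :=
    Nat.findGreatest_spec (P := fun j => dist (g 0) (g j) ≤ t) (Nat.zero_le n) (by simpa using h0)
  refine ⟨_, hle, ?_, hP⟩
  rcases hle.eq_or_lt with heq | hlt
  · rw [heq]; linarith
  · have hnot : ¬ dist (g 0) (g (Nat.findGreatest (fun j => dist (g 0) (g j) ≤ t) n + 1)) ≤ t :=
      Nat.findGreatest_is_greatest (P := fun j => dist (g 0) (g j) ≤ t) (Nat.lt_succ_self _) hlt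
    have := hstep _ hlt
    linarith [dist_triangle (g 0) (g (Nat.findGreatest (fun j => dist (g 0) (g j) ≤ t) n))
      (g (Nat.findGreatest (fun j => dist (g 0) (g j) ≤ t) n + 1))]

/-- A point coarsely between the endpoints of a coarsely straight chain is close to the chain. -/
theorem FourPoint.exists_dist_le_of_gp_le {δ s D E : ℝ} (h : FourPoint X δ)
    {g : ℕ → X} {n : ℕ} (hs : 0 ≤ s) (hD : 0 ≤ D)
    (hstep : ∀ j < n, dist (g j) (g (j + 1)) ≤ s)
    (hg : ∀ j ≤ n, gp (g j) (g 0) (g n) ≤ D) {p : X} (hp : gp p (g 0) (g n) ≤ E) :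
    ∃ j ≤ n, dist p (g j) ≤ E + 2 * s + 2 * D + 2 * δ := by
  -- The right point of the chain is the one whose distance to `g 0` is about that of the projection
  -- of `p`, namely the product of `p` and `g n` based at `g 0`.
  obtain ⟨j, hj, hj₁, hj₂⟩ := exists_dist_mem_Icc (t := gp (g 0) p (g n)) hs hstep
    (gp_nonneg _ _ _) (by rw [gp_comm, dist_comm]; exact gp_le_dist _ _ _)
  refine ⟨j, hj, ?_⟩
  have h₁ := gp_add_gp (g 0) p (g n)
  have h₂ := gp_add_gp (g 0) (g j) (g n)
  have h₃ := hg j hj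
  have h₄ := h.le (w := g 0) (x := p) (y := g n) (z := g j) (t := gp (g 0) p (g n) - s - D)
    (by linarith) (by linarith [gp_comm (g 0) (g j) (g n)])
  rw [gp_eq (g 0) p (g j)] at h₄
  linarith [dist_comm p (g 0), dist_comm (g j) (g 0)]

end Hyperbolic

/-! ## Quasi-isometric embeddings -/

section QuasiIsometry

variable {X Y : Type*} [MetricSpace X] [MetricSpace Y]

/-- `ψ` is a quasi-isometric embedding with constants `Λ` and `c`. -/
def IsQIEmbedding (Λ c : ℝ) (ψ : Y → X) : Prop :=
  ∀ y y' : Y, dist y y' / Λ - c ≤ dist (ψ y) (ψ y') ∧ dist (ψ y) (ψ y') ≤ Λ * dist y y' + c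

variable {Λ c δ : ℝ} {ψ : Y → X}

theorem IsQIEmbedding.dist_le (hψ : IsQIEmbedding Λ c ψ) (hΛ : 1 ≤ Λ) (y y' : Y) :
    dist y y' ≤ Λ * (dist (ψ y) (ψ y') + c) := by
  have h₁ := (hψ y y').1
  have h₂ : dist y y' / Λ ≤ dist (ψ y) (ψ y') + c := by linarith
  rw [div_le_iff₀ (by linarith)] at h₂
  linarith

/-- The image of a rough geodesic is a `(Λ, Λ + c)` quasi-geodesic whatever its length, so the Morse
lemma applies with uniform constants. -/
theorem IsQIEmbedding.exists_gp_le (hψ : IsQIEmbedding Λ c ψ) (hΛ : 1 ≤ Λ) (hc : 0 ≤ c)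
    (hδ : 0 ≤ δ) (h : FourPoint X δ) (hX : IsRoughlyGeodesic X) :
    ∃ D : ℝ, 0 ≤ D ∧ ∀ (g : ℕ → Y) (n : ℕ), IsRoughGeodesic g n →
      ∀ i ≤ n, gp (ψ (g i)) (ψ (g 0)) (ψ (g n)) ≤ D := by
  obtain ⟨D, hD, hM⟩ := h.exists_gp_le_of_quasiGeodesic (K := Λ) (C := Λ + c) hδ hX hΛ
    (by linarith)
  refine ⟨D, hD, fun g n hg i hi => ?_⟩
  have := hM (fun k : ℤ => ψ (g k.toNat)) 0 n (fun k hk l hl => ?_) i ⟨by omega, by omega⟩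
  · simpa using this
  · obtain ⟨k, rfl⟩ := Int.eq_ofNat_of_zero_le hk.1
    obtain ⟨l, rfl⟩ := Int.eq_ofNat_of_zero_le hl.1
    have hkn : k ≤ n := by have := hk.2; omega
    have hln : l ≤ n := by have := hl.2; omega
    have h₁ := abs_le.1 (hg k hkn l hln)
    have h₂ := hψ (g k) (g l)
    simp only [Int.toNat_natCast, Int.cast_natCast]
    have hΛ0 : 0 < Λ := by linarith
    constructor
    · have h₃ : |(k : ℝ) - l| / Λ ≤ (dist (g k) (g l) + 1) / Λ := by gcongr; linarith
      have h₄ : 1 / Λ ≤ 1 := by rw [div_le_one hΛ0]; exact hΛ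
      rw [add_div] at h₃
      linarith
    · have h₃ : Λ * dist (g k) (g l) ≤ Λ * (|(k : ℝ) - l| + 1) := by gcongr; linarith
      linarith

/-- Hyperbolicity passes to roughly geodesic spaces which embed quasi-isometrically. -/
theorem IsQIEmbedding.exists_fourPoint (hψ : IsQIEmbedding Λ c ψ) (hΛ : 1 ≤ Λ) (hc : 0 ≤ c)
    (hδ : 0 ≤ δ) (h : FourPoint X δ) (hX : IsRoughlyGeodesic X) (hY : IsRoughlyGeodesic Y) :
    ∃ δ' : ℝ, 0 ≤ δ' ∧ FourPoint Y δ' := by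
  obtain ⟨D, hD, hM⟩ := hψ.exists_gp_le hΛ hc hδ h hX
  set s := 2 * Λ + c
  have hs : 0 ≤ s := by positivity
  have hstep : ∀ (g : ℕ → Y) (n : ℕ), IsRoughGeodesic g n → ∀ j < n,
      dist (ψ (g j)) (ψ (g (j + 1))) ≤ s := by
    intro g n hg j hj
    have h₁ := hg.dist_le (Nat.le_succ j) hj
    rw [Nat.succ_eq_add_one] at h₁
    push_cast at h₁
    have h₂ := (hψ (g j) (g (j + 1))).2
    have : Λ * dist (g j) (g (j + 1)) ≤ Λ * 2 := by gcongr; linarith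
    linarith
  -- Being coarsely between two points can be pulled back: if `ψ p` is close to the image of a rough
  -- geodesic from `x` to `y`, then `p` is close to that rough geodesic.
  have hstar : ∀ E : ℝ, ∀ p x y : Y, gp (ψ p) (ψ x) (ψ y) ≤ E →
      gp p x y ≤ 3 / 2 + Λ * (E + 2 * s + 2 * D + 2 * δ + c) := by
    intro E p x y hE
    obtain ⟨n, g, rfl, rfl, hg⟩ := hY x y
    obtain ⟨j, hj, hdj⟩ := h.exists_dist_le_of_gp_le (g := fun i => ψ (g i)) hs hD
      (hstep g n hg) (fun i hi => hM g n hg i hi) hE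
    have h₁ := hψ.dist_le hΛ p (g j)
    have h₂ := gp_base_le p (g j) (g 0) (g n)
    have h₃ := hg.gp_le (Nat.zero_le j) hj le_rfl
    have : Λ * (dist (ψ p) (ψ (g j)) + c) ≤ Λ * (E + 2 * s + 2 * D + 2 * δ + c) := by gcongr
    linarith
  set E := 2 * s + 2 * D + 3 * δ
  set E' := 3 / 2 + Λ * (E + 2 * s + 2 * D + 2 * δ + c)
  replace hstar : ∀ p x y : Y, gp (ψ p) (ψ x) (ψ y) ≤ E → gp p x y ≤ E' := hstar E
  refine ⟨3 * E', by positivity, fun w x y z => ?_⟩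
  obtain ⟨n, g, rfl, rfl, hg⟩ := hY w x
  -- The point `ψ (g j)` is a coarse centre of the triangle with vertices `ψ w`, `ψ x`, `ψ z`, so `g
  -- j` is coarsely between any two of `w`, `x`, `z`.
  obtain ⟨j, hj, hj₁, hj₂⟩ := exists_dist_mem_Icc (g := fun i => ψ (g i))
    (t := gp (ψ (g 0)) (ψ (g n)) (ψ z)) hs (hstep g n hg) (gp_nonneg _ _ _)
    (by rw [dist_comm]; exact gp_le_dist _ _ _)
  have h₁ := hM g n hg j hj
  have h₂ := gp_add_gp (ψ (g 0)) (ψ (g j)) (ψ (g n))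
  have h₃ := h.le (w := ψ (g 0)) (x := ψ (g j)) (y := ψ (g n)) (z := ψ z)
    (t := gp (ψ (g 0)) (ψ (g n)) (ψ z) - s - D) (by linarith) (by linarith)
  have h₄ := gp_add_gp (ψ (g 0)) (ψ (g j)) (ψ z)
  have hwx := hstar (g j) (g 0) (g n) (by linarith)
  have hwz := hstar (g j) (g 0) z (by linarith)
  have hxz' : gp (ψ (g j)) (ψ (g n)) (ψ z) ≤ E - δ := by
    have h₅ := gp_eq (ψ (g j)) (ψ (g n)) (ψ z)
    have h₆ := gp_eq (ψ (g j)) (ψ (g 0)) (ψ z)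
    have h₇ := gp_eq (ψ (g j)) (ψ (g 0)) (ψ (g n))
    have h₈ := gp_eq (ψ (g 0)) (ψ (g n)) (ψ z)
    linarith [dist_comm (ψ z) (ψ (g 0)), dist_comm (ψ (g n)) (ψ (g 0))]
  have hxz := hstar (g j) (g n) z (by linarith)
  have hbase : dist (g 0) (g j) - 2 * E' ≤ gp (g 0) (g n) z := by
    have h₅ := gp_nonneg (g j) (g n) z
    have h₆ := gp_eq (g j) (g n) z
    have h₇ := gp_eq (g j) (g 0) z
    have h₈ := gp_eq (g j) (g 0) (g n)
    have h₉ := gp_eq (g 0) (g n) z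
    linarith [dist_comm z (g 0), dist_comm (g n) (g 0)]
  -- At the centre, the four point condition in `X` makes the product of `x`, `y` or that of `y`,
  -- `z` small; `hstar` transfers this to `Y`.
  have hmin : min (gp (g 0) (g n) y) (gp (g 0) y z) ≤ dist (g 0) (g j) + E' := by
    rcases min_le_iff.1 ((sub_le_iff_le_add.1 (h (ψ (g j)) (ψ (g n)) (ψ y) (ψ z))).trans
      (by linarith : _ ≤ E)) with hm | hm
    · refine (min_le_left _ _).trans ?_
      linarith [hstar _ _ _ hm, gp_base_le (g 0) (g j) (g n) y]
    · refine (min_le_right _ _).trans ?_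
      linarith [hstar _ _ _ hm, gp_base_le (g 0) (g j) y z]
  linarith

/-- Quasi-isometric embeddings coarsely preserve Gromov products. -/
theorem IsQIEmbedding.exists_le_gp (hψ : IsQIEmbedding Λ c ψ) (hΛ : 1 ≤ Λ) (hc : 0 ≤ c)
    (hδ : 0 ≤ δ) (h : FourPoint X δ) (hX : IsRoughlyGeodesic X) (hY : IsRoughlyGeodesic Y)
    {δ' : ℝ} (hδ' : 0 ≤ δ') (h' : FourPoint Y δ') :
    ∃ c' : ℝ, ∀ w x y : Y, gp w x y / Λ - c' ≤ gp (ψ w) (ψ x) (ψ y) := by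
  obtain ⟨D, hD, hM⟩ := hψ.exists_gp_le hΛ hc hδ h hX
  set B := Λ * (7 + 4 * δ') + c
  have hB : 0 ≤ B := by positivity
  refine ⟨2 + c + D + 2 * B + δ, fun w x y => ?_⟩
  -- Points `u` and `v` on rough geodesics from `w` to `x` and from `w` to `y`, at distance about
  -- `gp w x y` from `w`, are close to each other, hence so are their images. These images are
  -- coarsely on the way from `ψ w` to `ψ x` and to `ψ y`, which forces a large product downstairs.
  have key : ∀ z : Y, gp w x y ≤ dist w z → ∃ u : Y, gp w x y - 2 ≤ dist w u ∧
      dist w u ≤ gp w x y ∧ gp w x y - 7 / 2 ≤ gp w u z ∧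
      dist (ψ w) (ψ u) - D ≤ gp (ψ w) (ψ u) (ψ z) := by
    intro z hz
    obtain ⟨n, g, rfl, rfl, hg⟩ := hY w z
    obtain ⟨j, hj, hj₁, hj₂⟩ := exists_dist_mem_Icc (g := g) (s := 2) zero_le_two
      (fun j hj => by
        have h₁ := hg.dist_le (Nat.le_succ j) hj
        rw [Nat.succ_eq_add_one] at h₁
        push_cast at h₁
        linarith) (gp_nonneg _ _ _) hz
    have h₁ := hM g n hg j hj
    have h₂ := gp_add_gp (ψ (g 0)) (ψ (g j)) (ψ (g n))
    have h₃ := gp_add_gp (g 0) (g j) (g n)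
    have h₄ := hg.gp_le (Nat.zero_le j) hj le_rfl
    exact ⟨g j, hj₁, hj₂, by linarith, by linarith⟩
  obtain ⟨u, hu₁, hu₂, hu₃, hu₄⟩ := key x (by rw [dist_comm]; exact gp_le_dist _ _ _)
  obtain ⟨v, hv₁, hv₂, hv₃, hv₄⟩ := key y (by rw [dist_comm, gp_comm]; exact gp_le_dist _ _ _)
  have h₁ := h'.le (w := w) (x := u) (y := x) (z := y) (t := gp w x y - 7 / 2) hu₃ (by linarith)
  have h₂ := h'.le (w := w) (x := u) (y := y) (z := v) (t := gp w x y - 7 / 2 - δ') h₁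
    (by linarith [gp_comm w v y])
  have h₃ : dist u v ≤ 7 + 4 * δ' := by
    rw [gp_eq w u v] at h₂
    linarith [dist_comm u w, dist_comm v w]
  have h₄ : dist (ψ u) (ψ v) ≤ B := by
    refine (hψ u v).2.trans ?_
    have : Λ * dist u v ≤ Λ * (7 + 4 * δ') := by gcongr
    linarith
  have h₅ := gp_left_le (ψ w) (ψ v) (ψ u) (ψ y)
  rw [dist_comm (ψ v)] at h₅
  have h₆ := dist_triangle_right (ψ w) (ψ u) (ψ v)
  rw [dist_comm (ψ u)] at h₆
  have h₇ := h.le (w := ψ w) (x := ψ x) (y := ψ u) (z := ψ y)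
    (t := dist (ψ w) (ψ u) - D - 2 * B) (by rw [gp_comm]; linarith)
    (by linarith [dist_triangle (ψ w) (ψ v) (ψ u), dist_comm (ψ u) (ψ v)])
  have h₈ := (hψ w u).1
  have hΛ0 : 0 < Λ := by linarith
  have h₉ : gp w x y / Λ ≤ (dist w u + 2) / Λ := by gcongr; linarith
  have h₁₀ : 2 / Λ ≤ 2 := by rw [div_le_iff₀ hΛ0]; linarith
  rw [add_div] at h₉
  linarith

end QuasiIsometry

/-! ### Bi-infinite geodesics near quasi-geodesics -/

section DiscreteGeodesics

variable {Y : Type*} [MetricSpace Y]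

/-- Any two points are joined by a geodesic indexed by an interval of integers. -/
def IsDiscreteGeodesicSpace (Y : Type*) [MetricSpace Y] : Prop :=
  ∀ x y : Y, ∃ (n : ℕ) (g : ℕ → Y), g 0 = x ∧ g n = y ∧
    ∀ i ≤ n, ∀ j ≤ n, dist (g i) (g j) = |(i : ℝ) - j|

theorem IsDiscreteGeodesicSpace.isRoughlyGeodesic (hY : IsDiscreteGeodesicSpace Y) :
    IsRoughlyGeodesic Y := by
  intro x y
  obtain ⟨n, g, h0, hn, hg⟩ := hY x y
  exact ⟨n, g, h0, hn, fun i hi j hj => by rw [hg i hi j hj]; simp⟩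

theorem IsQuasiGeodesic.abs_le {K C : ℝ} {q : ℤ → Y} (hK : 1 ≤ K) (hq : IsQuasiGeodesic K C q)
    (m n : ℤ) : |(m : ℝ) - n| ≤ K * (dist (q m) (q n) + C) := by
  have h₁ := (hq m n).1
  have h₂ : |(m : ℝ) - n| / K ≤ dist (q m) (q n) + C := by linarith
  rw [div_le_iff₀ (by linarith)] at h₂
  linarith

/-- Finite-length approximations of a geodesic with the endpoints of a given quasi-geodesic. -/
theorem FourPoint.exists_geodesic_segment_near {δ K C : ℝ} (hδ : 0 ≤ δ) (h : FourPoint Y δ)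
    (hY : IsDiscreteGeodesicSpace Y) (hK : 1 ≤ K) (hC : 0 ≤ C) :
    ∃ B : ℝ, 0 ≤ B ∧ ∃ n₀ : ℤ, ∀ q : ℤ → Y, IsQuasiGeodesic K C q → ∀ N : ℕ,
      ∃ (γ : ℤ → Y) (m : ℤ → ℤ), dist (q 0) (γ 0) ≤ B ∧
        (∀ i j : ℤ, K * (|(i : ℝ)| + B + C) ≤ N → K * (|(j : ℝ)| + B + C) ≤ N →
          dist (γ i) (γ j) = |(i : ℝ) - j|) ∧
        ∀ n : ℤ, |n| ≤ N → dist (q n) (γ (m n)) ≤ B ∧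
          |(m n : ℝ)| ≤ dist (q n) (q 0) + 2 * B ∧
          (n₀ ≤ n → 0 ≤ m n) ∧ (n ≤ -n₀ → m n ≤ 0) := by
  obtain ⟨D, hD, hM⟩ := h.exists_gp_le_of_quasiGeodesic hδ hY.isRoughlyGeodesic hK hC
  set B := D + 2 * 1 + 2 * 0 + 2 * δ
  have hB : 0 ≤ B := by positivity
  -- If `q n` projected to the wrong side of `q 0`, then `dist (q n) (q 0) ≤ D + 2 * B`, so `|n| ≤ K
  -- * (D + 2 * B + C)`. The threshold `n₀` lies just beyond this and does not depend on `N`.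
  refine ⟨B, hB, ⌊K * (D + 2 * B + C)⌋ + 1, fun q hq N => ?_⟩
  have hMq : ∀ a b i : ℤ, a ≤ i → i ≤ b → gp (q i) (q a) (q b) ≤ D := fun a b i ha hb =>
    hM q a b (fun m _ n _ => hq m n) i ⟨ha, hb⟩
  obtain ⟨L, g, h0, hL, hg⟩ := hY (q (-N)) (q N)
  have hg' : ∀ i j, i ≤ j → j ≤ L → dist (g i) (g j) = (j : ℝ) - i := fun i j hij hj => by
    have : (i : ℝ) ≤ j := by exact_mod_cast hij
    rw [hg i (hij.trans hj) j hj, abs_of_nonpos (by linarith)]; ring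
  have hnear : ∀ n : ℤ, ∃ j ≤ L, |n| ≤ N → dist (q n) (g j) ≤ B := by
    intro n
    by_cases hn : |n| ≤ N
    · have hn' := abs_le.1 hn
      obtain ⟨j, hj, hd⟩ := h.exists_dist_le_of_gp_le (g := g) (n := L) (s := 1) (D := 0) (E := D)
        (p := q n) zero_le_one le_rfl (fun j hj => by
          rw [hg' j (j + 1) (Nat.le_succ j) hj]; push_cast; linarith) (fun j hj => by
          rw [gp_eq, hg' 0 j (Nat.zero_le j) hj, dist_comm (g L), hg' j L hj le_rfl,
            hg' 0 L (Nat.zero_le _) le_rfl]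
          push_cast
          linarith) (by rw [h0, hL]; exact hMq _ _ _ hn'.1 hn'.2)
      exact ⟨j, hj, fun _ => hd⟩
    · exact ⟨0, Nat.zero_le _, fun h => absurd h hn⟩
  choose j hjL hj using hnear
  have hj0 := hj 0 (by simp)
  have hqN : ((N : ℤ) : ℝ) ≤ K * (dist (q 0) (q N) + C) := by
    have := hq.abs_le hK 0 N
    rwa [Int.cast_zero, zero_sub, abs_neg, abs_of_nonneg (by positivity)] at this
  have hqN' : ((N : ℤ) : ℝ) ≤ K * (dist (q (-N)) (q 0) + C) := by
    have := hq.abs_le hK (-N) 0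
    rw [Int.cast_zero, sub_zero, Int.cast_neg, abs_neg, abs_of_nonneg (by positivity)] at this
    exact this
  have hK0 : 0 < K := by linarith
  have hrange : ∀ i : ℤ, K * (|(i : ℝ)| + B + C) ≤ N → 0 ≤ i + j 0 ∧ i + j 0 ≤ L := by
    intro i hi
    have h₁ := hg' 0 (j 0) (Nat.zero_le _) (hjL 0)
    have h₂ := hg' (j 0) L (hjL 0) le_rfl
    rw [h0] at h₁
    rw [hL] at h₂
    push_cast at *
    have h₃ := le_of_mul_le_mul_left (hi.trans hqN) hK0
    have h₄ := le_of_mul_le_mul_left (hi.trans hqN') hK0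
    have h₅ := dist_triangle (q (-N)) (g (j 0)) (q 0)
    have h₆ := dist_triangle (q 0) (g (j 0)) (q N)
    have h₇ := neg_abs_le (i : ℝ)
    have h₈ := le_abs_self (i : ℝ)
    rw [dist_comm (g (j 0)) (q 0)] at h₅
    constructor
    · have : (0 : ℝ) ≤ i + j 0 := by linarith
      exact_mod_cast this
    · have : (i : ℝ) + j 0 ≤ L := by linarith
      exact_mod_cast this
  refine ⟨fun i => g (i + j 0).toNat, fun n => j n - j 0, by simpa using hj0, ?_, ?_⟩
  · intro i k hi hk
    obtain ⟨hi₁, hi₂⟩ := hrange i hi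
    obtain ⟨hk₁, hk₂⟩ := hrange k hk
    change dist (g (i + j 0).toNat) (g (k + j 0).toNat) = _
    rw [hg _ (by omega) _ (by omega)]
    have e₁ : (((i + j 0).toNat : ℕ) : ℝ) = i + j 0 := by
      exact_mod_cast congrArg (Int.cast : ℤ → ℝ) (Int.toNat_of_nonneg hi₁)
    have e₂ : (((k + j 0).toNat : ℕ) : ℝ) = k + j 0 := by
      exact_mod_cast congrArg (Int.cast : ℤ → ℝ) (Int.toNat_of_nonneg hk₁)
    rw [e₁, e₂]
    congr 1
    ring
  · intro n hn
    have hn' := abs_le.1 hn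
    have hjn := hj n hn
    have hd₁ := dist_triangle4 (g (j n)) (q n) (q 0) (g (j 0))
    have hd₂ := dist_triangle4 (q n) (g (j n)) (g (j 0)) (q 0)
    have hd₃ := dist_comm (g (j n)) (q n)
    have hd₄ := dist_comm (g (j 0)) (q 0)
    have hsmall : dist (q n) (q 0) ≤ D + 2 * B → |(n : ℝ)| ≤ K * (D + 2 * B + C) := by
      intro hs
      have h₁ := hq.abs_le hK n 0
      rw [Int.cast_zero, sub_zero] at h₁
      refine h₁.trans ?_
      gcongr
    refine ⟨by simpa using hjn, ?_, fun hn₀ => ?_, fun hn₀ => ?_⟩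
    · push_cast
      have := hg (j n) (hjL n) (j 0) (hjL 0)
      linarith
    -- The distance from `q 0` to `q n` is at most `2 * B + (j 0 - j n)` through the geodesic, and
    -- at most `2 * D + 2 * B - (j 0 - j n)` because `q n` is coarsely between `q 0` and `q N`. The
    -- average of the two bounds is `D + 2 * B`.
    · by_contra! hlt
      have hlt' : j n ≤ j 0 := by omega
      have h₁ := hg' (j n) (j 0) hlt' (hjL 0)
      have h₂ := hg' (j 0) L (hjL 0) le_rfl
      have h₃ := hg' (j n) L (hjL n) le_rfl
      rw [hL] at h₂ h₃
      have h0n : 0 ≤ n := by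
        have : 0 ≤ ⌊K * (D + 2 * B + C)⌋ := Int.floor_nonneg.2 (by positivity)
        omega
      have h₄ := hMq 0 N n h0n hn'.2
      rw [gp_eq, dist_comm (q 0) (q n), dist_comm (q N) (q n)] at h₄
      have h₅ := dist_triangle (g (j n)) (q n) (q N)
      have h₆ := dist_triangle (q 0) (g (j 0)) (q N)
      have h₇ := hsmall (by linarith)
      have h₈ := (Int.floor_lt.1 (Int.lt_of_add_one_le hn₀))
      linarith [le_abs_self (n : ℝ)]
    · by_contra! hlt
      have hlt' : j 0 ≤ j n := by omega
      have h₁ := hg' (j 0) (j n) hlt' (hjL n)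
      have h₂ := hg' 0 (j 0) (Nat.zero_le _) (hjL 0)
      have h₃ := hg' 0 (j n) (Nat.zero_le _) (hjL n)
      rw [h0] at h₂ h₃
      have h0n : n ≤ 0 := by
        have : 0 ≤ ⌊K * (D + 2 * B + C)⌋ := Int.floor_nonneg.2 (by positivity)
        omega
      have h₄ := hMq (-N) 0 n hn'.1 h0n
      rw [gp_eq, dist_comm (q 0) (q n)] at h₄
      have h₅ := dist_triangle (q (-N)) (q n) (g (j n))
      have h₆ := dist_triangle (q (-N)) (g (j 0)) (q 0)
      have h₉ := dist_comm (g (j 0)) (g (j n))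
      have h₇ := hsmall (by linarith)
      have h₈ : K * (D + 2 * B + C) < ((-n : ℤ) : ℝ) := Int.floor_lt.1 (by omega)
      push_cast at h₈
      linarith [neg_abs_le (n : ℝ)]

/-- Compactness in place of a diagonal extraction: one ultrafilter makes all the finitely-valued
sequences constant at once. -/
theorem exists_eventually_eq_of_finite {ι β : Type*} (U : Ultrafilter ι) {F : Set β}
    (hF : F.Finite) {u : ι → β} (hu : ∀ᶠ i in (U : Filter ι), u i ∈ F) :
    ∃ v ∈ F, ∀ᶠ i in (U : Filter ι), u i = v := by
  refine (Ultrafilter.finite_biUnion_mem_iff hF (s := fun v => {i | u i = v})).1 ?_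
  refine mem_of_superset hu fun i hi => ?_
  exact Set.mem_biUnion (show u i ∈ F from hi) rfl

/-- In a locally finite hyperbolic space, a bi-infinite quasi-geodesic is close to a bi-infinite
geodesic with the same endpoints. -/
theorem FourPoint.exists_geodesic_near {δ K C : ℝ} (hδ : 0 ≤ δ) (h : FourPoint Y δ)
    (hY : IsDiscreteGeodesicSpace Y) (hfin : ∀ (x : Y) (r : ℝ), (Metric.closedBall x r).Finite)
    (hK : 1 ≤ K) (hC : 0 ≤ C) :
    ∃ B : ℝ, 0 ≤ B ∧ ∃ n₀ : ℤ, ∀ q : ℤ → Y, IsQuasiGeodesic K C q →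
      ∃ (l : ℤ → Y) (m : ℤ → ℤ), (∀ i j : ℤ, dist (l i) (l j) = |(i : ℝ) - j|) ∧
        ∀ n : ℤ, dist (q n) (l (m n)) ≤ B ∧ (n₀ ≤ n → 0 ≤ m n) ∧ (n ≤ -n₀ → m n ≤ 0) := by
  obtain ⟨B, hB, n₀, H⟩ := h.exists_geodesic_segment_near hδ hY hK hC
  refine ⟨B, hB, n₀, fun q hq => ?_⟩
  choose γ m h0 hγ hm using H q hq
  -- The limit geodesic and its matching `m'` are limits of the segments along a nonprincipal
  -- ultrafilter. Every relation to be checked involves finitely many indices, so it can be read off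
  -- a single segment.
  set U : Ultrafilter ℕ := hyperfilter ℕ
  have hU : ∀ x : ℝ, ∀ᶠ N : ℕ in (U : Filter ℕ), x ≤ N := fun x =>
    (tendsto_natCast_atTop_atTop.eventually_ge_atTop x).filter_mono Nat.hyperfilter_le_atTop
  have hl : ∀ i : ℤ, ∃ v ∈ Metric.closedBall (q 0) (|(i : ℝ)| + B),
      ∀ᶠ N in (U : Filter ℕ), γ N i = v := by
    intro i
    refine exists_eventually_eq_of_finite U (hfin _ _) ?_
    filter_upwards [hU (K * (|(i : ℝ)| + B + C)), hU (K * (|((0 : ℤ) : ℝ)| + B + C))] with N h₁ h₂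
    rw [Metric.mem_closedBall]
    have h₃ := hγ N i 0 h₁ h₂
    rw [Int.cast_zero, sub_zero] at h₃
    linarith [dist_triangle (γ N i) (γ N 0) (q 0), dist_comm (γ N 0) (q 0), h0 N]
  have hm' : ∀ n : ℤ, ∃ v ∈ Set.Icc (-⌈dist (q n) (q 0) + 2 * B⌉) ⌈dist (q n) (q 0) + 2 * B⌉,
      ∀ᶠ N in (U : Filter ℕ), m N n = v := by
    intro n
    refine exists_eventually_eq_of_finite U (Set.finite_Icc _ _) ?_
    filter_upwards [hU |(n : ℝ)|] with N hN
    have h₁ := (hm N n (by exact_mod_cast hN)).2.1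
    have h₂ : (|m N n| : ℤ) ≤ ⌈dist (q n) (q 0) + 2 * B⌉ := by
      have : ((|m N n| : ℤ) : ℝ) ≤ ⌈dist (q n) (q 0) + 2 * B⌉ := by
        push_cast; exact h₁.trans (Int.le_ceil _)
      exact_mod_cast this
    exact _root_.abs_le.1 h₂
  choose l _ hl using hl
  choose m' _ hm' using hm'
  refine ⟨l, m', fun i j => ?_, fun n => ?_⟩
  · obtain ⟨N, hi, hj, h₁, h₂⟩ := ((hl i).and ((hl j).and ((hU (K * (|(i : ℝ)| + B + C))).and
      (hU (K * (|(j : ℝ)| + B + C)))))).exists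
    rw [← hi, ← hj]
    exact hγ N i j h₁ h₂
  · obtain ⟨N, hmn, hln, hN⟩ := ((hm' n).and ((hl (m' n)).and (hU |(n : ℝ)|))).exists
    obtain ⟨h₁, -, h₂, h₃⟩ := hm N n (by exact_mod_cast hN)
    rw [hmn] at h₁ h₂ h₃
    rw [hln] at h₁
    exact ⟨h₁, h₂, h₃⟩

end DiscreteGeodesics

/-! ## Isometries with large translation length -/

section Translation

variable {Y : Type*} [MetricSpace Y]

/-- The orbit of a point of minimal and large displacement is a quasi-geodesic. -/
theorem FourPoint.le_dist_iterate {δ : ℝ} (hδ : 0 ≤ δ) (h : FourPoint Y δ)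
    (hY : IsDiscreteGeodesicSpace Y) {T : Y → Y} (hT : Isometry T) {y : Y}
    (hmin : ∀ z, dist y (T y) ≤ dist z (T z)) (hlarge : 6 * δ + 4 < dist y (T y)) (k : ℕ) :
    k * (dist y (T y) - 6 * δ) ≤ dist y (T^[k] y) := by
  obtain ⟨n, g, h0, hn, hg⟩ := hY y (T y)
  have hn2 : n / 2 ≤ n := Nat.div_le_self n 2
  have e₁ := hg 0 (Nat.zero_le n) n le_rfl
  have e₂ := hg 0 (Nat.zero_le n) (n / 2) hn2
  have e₃ := hg (n / 2) hn2 n le_rfl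
  have hcast : ((n / 2 : ℕ) : ℝ) ≤ n := by exact_mod_cast hn2
  have hhalf : (n : ℝ) ≤ 2 * (n / 2 : ℕ) + 1 := by
    exact_mod_cast (by omega : n ≤ 2 * (n / 2) + 1)
  have hhalf' : 2 * ((n / 2 : ℕ) : ℝ) ≤ n := by
    exact_mod_cast (by omega : 2 * (n / 2) ≤ n)
  have hpos : (0 : ℝ) ≤ (n / 2 : ℕ) := by positivity
  rw [h0, hn, Nat.cast_zero, zero_sub, abs_neg, abs_of_nonneg (by positivity)] at e₁
  rw [h0, Nat.cast_zero, zero_sub, abs_neg, abs_of_nonneg hpos] at e₂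
  rw [hn, abs_of_nonpos (by linarith)] at e₃
  set m := g (n / 2)
  have hd := hmin m
  -- If the path from `y` to `T y` to `T (T y)` backtracked by more than `2 * δ`, its corner could
  -- be cut: the midpoint `m` of the first side and its image `T m` would be closer than `y` and `T
  -- y`, against minimality.
  have hturn : gp (T y) y (T (T y)) ≤ 2 * δ := by
    by_contra! hlt
    have f₁ := hT.dist_eq y m
    have f₂ := hT.dist_eq m (T y)
    have f₃ := hT.dist_eq y (T y)
    have h₁ : 2 * δ < (n / 2 : ℕ) := by linarith
    set t := min ((n / 2 : ℕ) : ℝ) (gp (T y) y (T (T y)))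
    have ht : 2 * δ < t := lt_min h₁ hlt
    have ht₁ : t ≤ (n / 2 : ℕ) := min_le_left _ _
    have ht₂ : t ≤ gp (T y) y (T (T y)) := min_le_right _ _
    have h₂ := h.le (w := T y) (x := m) (y := y) (z := T (T y)) (t := t)
      (by rw [gp_eq, dist_comm m y]; linarith) ht₂
    have h₃ := h.le (w := T y) (x := m) (y := T (T y)) (z := T m) (t := t - δ) h₂
      (by rw [gp_eq, dist_comm (T (T y)) (T y), dist_comm (T (T y)) (T m),
            dist_comm (T m) (T y)]; linarith)
    rw [gp_eq, dist_comm (T m) (T y)] at h₃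
    linarith
  have hTi : ∀ i, Isometry T^[i] := fun i => by
    induction i with
    | zero => exact isometry_id
    | succ i ih => exact ih.comp hT
  have hchain := h.le_dist_of_chain (c := 2 * δ) (ℓ := dist y (T y)) hδ (by linarith)
    (fun i => T^[i] y) (fun i => by
      rw [Function.iterate_succ_apply, (hTi i).dist_eq]) (fun i => by
      rw [Function.iterate_succ_apply, Function.iterate_succ_apply,
        Function.iterate_succ_apply, gp_eq, (hTi i).dist_eq, (hTi i).dist_eq,
        (hTi i).dist_eq]
      exact hturn) k
  simp only [Function.iterate_zero, id] at hchain
  linarith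

end Translation

/-! ## The word metric -/

section WordMetric

variable {Γ : Type*} [Group Γ] {S : Finset Γ}

theorem connected_mulCayley (hS : Subgroup.closure (S : Set Γ) = ⊤) :
    (SimpleGraph.mulCayley (S : Set Γ)).Connected := by
  have key : ∀ g : Γ, ∀ h, (SimpleGraph.mulCayley (S : Set Γ)).Reachable h (h * g) := by
    intro g
    have hg : g ∈ Subgroup.closure (S : Set Γ) := by rw [hS]; trivial
    induction hg using Subgroup.closure_induction with
    | mem s hs =>
      intro h
      by_cases he : h = h * s
      · rw [← he]
      · exact SimpleGraph.Adj.reachable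
          ((SimpleGraph.mulCayley_adj' _ _ _).2 ⟨he, s, hs, Or.inl rfl⟩)
    | one => intro h; rw [mul_one]
    | mul x y _ _ hx hy => intro h; rw [← mul_assoc]; exact (hx h).trans (hy (h * x))
    | inv x _ hx => intro h; simpa using (hx (h * x⁻¹)).symm
  have : Nonempty Γ := ⟨1⟩
  exact ⟨fun g h => by simpa using key (g⁻¹ * h) g⟩

variable (S) in
/-- The word metric as a metric space structure. -/
abbrev wordMetric (hS : Subgroup.closure (S : Set Γ) = ⊤) : MetricSpace Γ where
  dist g h := wordDist S g h
  dist_self g := by simp [wordDist]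
  dist_comm g h := by simp [wordDist, SimpleGraph.dist_comm]
  dist_triangle g h k := by exact_mod_cast (connected_mulCayley hS).dist_triangle
  eq_of_dist_eq_zero {g h} hgh := by
    rw [Nat.cast_eq_zero] at hgh
    exact (connected_mulCayley hS).dist_eq_zero_iff.1 hgh

/-- Invariance under left translation bounds every edge by one of the finitely many generators, and
the bound adds up along a walk. It applies to automorphisms, to the identity between two word
metrics and to orbit maps. -/
theorem exists_dist_le_mul_wordDist {Z : Type*} [PseudoMetricSpace Z]
    (hS : Subgroup.closure (S : Set Γ) = ⊤) (F : Γ → Z)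
    (hF : ∀ k g h, dist (F (k * g)) (F (k * h)) = dist (F g) (F h)) :
    ∃ Λ : ℝ, 1 ≤ Λ ∧ ∀ g h, dist (F g) (F h) ≤ Λ * wordDist S g h := by
  set Λ := 1 + ∑ s ∈ S, dist (F 1) (F s)
  have hΛ : ∀ s ∈ S, dist (F 1) (F s) ≤ Λ := fun s hs =>
    (Finset.single_le_sum (f := fun s => dist (F 1) (F s)) (fun _ _ => dist_nonneg) hs).trans
      (by simp [Λ])
  have hadj : ∀ g h, (SimpleGraph.mulCayley (S : Set Γ)).Adj g h → dist (F g) (F h) ≤ Λ := by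
    intro g h hgh
    obtain ⟨-, s, hs, rfl | rfl⟩ := (SimpleGraph.mulCayley_adj' _ _ _).1 hgh
    · have := hF g 1 s
      rw [mul_one] at this
      rw [this]; exact hΛ s hs
    · have := hF h 1 s
      rw [mul_one] at this
      rw [dist_comm, this]; exact hΛ s hs
  refine ⟨Λ, le_add_of_nonneg_right (Finset.sum_nonneg fun _ _ => dist_nonneg), fun g h => ?_⟩
  obtain ⟨p, hp⟩ := (connected_mulCayley hS).exists_walk_length_eq_dist g h
  have hwalk : ∀ {g h} (p : (SimpleGraph.mulCayley (S : Set Γ)).Walk g h),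
      dist (F g) (F h) ≤ Λ * p.length := by
    intro g h p
    induction p with
    | nil => simp
    | cons hadj' p ih =>
      rw [SimpleGraph.Walk.length_cons]
      push_cast
      linarith [dist_triangle _ _ _ |>.trans (add_le_add (hadj _ _ hadj') ih)]
  have := hwalk p
  rwa [hp] at this

theorem exists_wordDist_geodesic (hS : Subgroup.closure (S : Set Γ) = ⊤) (x y : Γ) :
    ∃ g : ℕ → Γ, g 0 = x ∧ g (wordDist S x y) = y ∧
      ∀ i k, i + k ≤ wordDist S x y → wordDist S (g i) (g (i + k)) = k := by
  have hconn := connected_mulCayley hS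
  obtain ⟨p, hp⟩ := hconn.exists_walk_length_eq_dist x y
  have hpd : p.length = wordDist S x y := hp
  have hle : ∀ i k, i + k ≤ p.length → wordDist S (p.getVert i) (p.getVert (i + k)) ≤ k := by
    intro i k
    induction k with
    | zero => intro _; simp [wordDist]
    | succ k ih =>
      intro hk
      have h₁ := ih (by omega)
      have h₂ : wordDist S (p.getVert (i + k)) (p.getVert (i + k + 1)) = 1 :=
        SimpleGraph.dist_eq_one_iff_adj.2 (p.adj_getVert_succ (by omega))
      have h₃ : wordDist S (p.getVert i) (p.getVert (i + k + 1)) ≤ _ :=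
        hconn.dist_triangle (v := p.getVert (i + k))
      change _ ≤ wordDist S _ _ + wordDist S _ _ at h₃
      rw [← add_assoc]
      omega
  refine ⟨p.getVert, p.getVert_zero, by rw [← hpd]; exact p.getVert_length, fun i k hk => ?_⟩
  rw [← hpd] at hk
  refine le_antisymm (hle i k hk) ?_
  have h₁ := hle 0 i (by omega)
  have h₂ := hle (i + k) (p.length - (i + k)) (by omega)
  rw [Nat.add_sub_cancel' hk, p.getVert_length] at h₂
  rw [zero_add, p.getVert_zero] at h₁
  have h₃ : wordDist S x y ≤ wordDist S x (p.getVert i) + wordDist S (p.getVert i) y :=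
    hconn.dist_triangle
  have h₄ : wordDist S (p.getVert i) y ≤ wordDist S (p.getVert i) (p.getVert (i + k)) +
    wordDist S (p.getVert (i + k)) y := hconn.dist_triangle
  omega

open scoped Pointwise in
theorem finite_wordDist_le (hS : Subgroup.closure (S : Set Γ) = ⊤) (x : Γ) (n : ℕ) :
    {y | wordDist S x y ≤ n}.Finite := by
  induction n with
  | zero =>
    refine (Set.finite_singleton x).subset fun y hy => ?_
    exact ((connected_mulCayley hS).dist_eq_zero_iff.1 (Nat.le_zero.1 hy)).symm
  | succ n ih =>
    refine (ih.mul ((S.finite_toSet.union S.finite_toSet.inv).insert 1)).subset fun y hy => ?_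
    rcases Nat.lt_or_ge n (wordDist S x y) with hlt | hle
    · have hy : wordDist S x y = n + 1 := le_antisymm hy hlt
      obtain ⟨g, h0, h1, hg⟩ := exists_wordDist_geodesic hS x y
      rw [hy] at h1
      have h₂ := hg 0 n (by omega)
      have h₃ := hg n 1 (by omega)
      rw [h0, zero_add] at h₂
      rw [h1] at h₃
      obtain ⟨-, s, hs, hsy⟩ :=
        (SimpleGraph.mulCayley_adj' _ _ _).1 (SimpleGraph.dist_eq_one_iff_adj.1 h₃)
      refine Set.mem_mul.2 ⟨g n, h₂.le, (g n)⁻¹ * y, ?_, by group⟩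
      rcases hsy with h | h
      · right; left
        rw [← h]; simpa using hs
      · right; right
        rw [h]; simpa using hs
    · exact Set.mem_mul.2 ⟨y, hle, 1, Set.mem_insert _ _, mul_one y⟩

section

variable [MetricSpace Γ]

/-- The metric is any instance that `hd` identifies with `d_S`, so that word metrics of different
generating sets can be used together. -/
theorem isDiscreteGeodesicSpace_of_wordDist (hS : Subgroup.closure (S : Set Γ) = ⊤)
    (hd : ∀ g h : Γ, dist g h = wordDist S g h) : IsDiscreteGeodesicSpace Γ := by
  intro x y
  obtain ⟨g, h0, h1, hg⟩ := exists_wordDist_geodesic hS x y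
  refine ⟨_, g, h0, h1, fun i hi j hj => ?_⟩
  rcases le_total i j with hij | hij
  · obtain ⟨k, rfl⟩ := Nat.exists_eq_add_of_le hij
    rw [hd, hg i k hj]; simp
  · obtain ⟨k, rfl⟩ := Nat.exists_eq_add_of_le hij
    rw [dist_comm, hd, hg j k hi]; simp

theorem finite_closedBall_of_wordDist (hS : Subgroup.closure (S : Set Γ) = ⊤)
    (hd : ∀ g h : Γ, dist g h = wordDist S g h) (x : Γ) (r : ℝ) :
    (Metric.closedBall x r).Finite := by
  refine (finite_wordDist_le hS x ⌊r⌋₊).subset fun y hy => ?_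
  rw [Metric.mem_closedBall, dist_comm, hd] at hy
  exact Nat.le_floor hy

theorem dist_mul_left_of_wordDist (hd : ∀ g h : Γ, dist g h = wordDist S g h) (k g h : Γ) :
    dist (k * g) (k * h) = dist g h := by
  rw [hd, hd, wordDist_mul_left]

/-- Automorphisms are quasi-isometries. -/
theorem exists_isQIEmbedding_mulAut (hS : Subgroup.closure (S : Set Γ) = ⊤)
    (hd : ∀ g h : Γ, dist g h = wordDist S g h) (ψ : MulAut Γ) :
    ∃ Λ : ℝ, 1 ≤ Λ ∧ IsQIEmbedding Λ 0 ψ := by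
  have hinv : ∀ φ : MulAut Γ, ∀ k g h, dist (φ (k * g)) (φ (k * h)) = dist (φ g) (φ h) :=
    fun φ k g h => by rw [map_mul, map_mul, dist_mul_left_of_wordDist hd]
  obtain ⟨Λ₁, h₁, hΛ₁⟩ := exists_dist_le_mul_wordDist hS ψ (hinv ψ)
  obtain ⟨Λ₂, h₂, hΛ₂⟩ := exists_dist_le_mul_wordDist hS ψ.symm (hinv ψ.symm)
  have hmax : 1 ≤ max Λ₁ Λ₂ := h₁.trans (le_max_left _ _)
  refine ⟨max Λ₁ Λ₂, hmax, fun g h => ⟨?_, ?_⟩⟩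
  · rw [sub_zero, div_le_iff₀ (by linarith)]
    have := hΛ₂ (ψ g) (ψ h)
    rw [MulEquiv.symm_apply_apply, MulEquiv.symm_apply_apply, ← hd, mul_comm] at this
    exact this.trans (by gcongr; exact le_max_right _ _)
  · rw [add_zero]
    refine (hΛ₁ g h).trans ?_
    rw [← hd]
    gcongr
    exact le_max_left _ _

end

/-- Hyperbolicity does not depend on the generating set. -/
theorem IsHyperbolicGroup.exists_fourPoint (hΓ : IsHyperbolicGroup Γ)
    (hS : Subgroup.closure (S : Set Γ) = ⊤) :
    ∃ δ : ℝ, 0 ≤ δ ∧ @FourPoint Γ (wordMetric S hS) δ := by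
  obtain ⟨S', hS', δ, hδ, h⟩ := hΓ
  obtain ⟨Λ₁, h₁, hΛ₁⟩ := @exists_dist_le_mul_wordDist Γ _ S Γ
    (wordMetric S' hS').toPseudoMetricSpace hS id
    (@dist_mul_left_of_wordDist Γ _ S' (wordMetric S' hS') fun _ _ => rfl)
  obtain ⟨Λ₂, h₂, hΛ₂⟩ := @exists_dist_le_mul_wordDist Γ _ S' Γ
    (wordMetric S hS).toPseudoMetricSpace hS' id
    (@dist_mul_left_of_wordDist Γ _ S (wordMetric S hS) fun _ _ => rfl)
  have hmax : 1 ≤ max Λ₁ Λ₂ := h₁.trans (le_max_left _ _)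
  have hQI : @IsQIEmbedding Γ Γ (wordMetric S' hS') (wordMetric S hS) (max Λ₁ Λ₂) 0 id := by
    intro x y
    have e₁ : (wordDist S' x y : ℝ) ≤ Λ₁ * wordDist S x y := hΛ₁ x y
    have e₂ : (wordDist S x y : ℝ) ≤ Λ₂ * wordDist S' x y := hΛ₂ x y
    constructor
    · change (wordDist S x y : ℝ) / _ - 0 ≤ wordDist S' x y
      rw [sub_zero, div_le_iff₀ (by linarith), mul_comm]
      exact e₂.trans (by gcongr; exact le_max_right _ _)
    · change (wordDist S' x y : ℝ) ≤ _ * (wordDist S x y : ℝ) + 0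
      rw [add_zero]
      exact e₁.trans (by gcongr; exact le_max_left _ _)
  exact @IsQIEmbedding.exists_fourPoint Γ Γ (wordMetric S' hS') (wordMetric S hS) _ _ _ _ hQI hmax
    le_rfl hδ.le h
    (@IsDiscreteGeodesicSpace.isRoughlyGeodesic Γ (wordMetric S' hS')
      (@isDiscreteGeodesicSpace_of_wordDist Γ _ S' (wordMetric S' hS') hS' fun _ _ => rfl))
    (@IsDiscreteGeodesicSpace.isRoughlyGeodesic Γ (wordMetric S hS)
      (@isDiscreteGeodesicSpace_of_wordDist Γ _ S (wordMetric S hS) hS fun _ _ => rfl))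

end WordMetric

/-! ## Axes -/

/-- Two points of a ray have product, from its origin, equal to the smaller parameter. The constant
`A` pays for moving the base point to `p` and for replacing `q j` by a nearby point of the ray. -/
theorem exists_le_gp_of_ray {Y : Type*} [MetricSpace Y] {l q : ℕ → Y} {p : Y} {B : ℝ} {n₀ : ℕ}
    (hl : ∀ i j : ℕ, dist (l i) (l j) = |(i : ℝ) - j|)
    (hq : ∀ n ≥ n₀, ∃ j, dist (q n) (l j) ≤ B)
    (hinf : ∀ R : ℝ, ∃ N : ℕ, ∀ n ≥ N, R ≤ dist p (q n)) (M : ℝ) :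
    ∃ N : ℕ, ∀ i ≥ N, ∀ j ≥ N, M ≤ gp p (l i) (q j) := by
  set A := M + dist (l 0) p + B
  obtain ⟨N, hN⟩ := hinf (A + dist (l 0) p + B)
  refine ⟨max n₀ (max N ⌈A⌉₊), fun i hi j hj => ?_⟩
  simp only [ge_iff_le, max_le_iff] at hi hj
  obtain ⟨k, hk⟩ := hq j hj.1
  have hi' : A ≤ i := (Nat.le_ceil A).trans (by exact_mod_cast hi.2.2)
  have h0 : ∀ k : ℕ, dist (l k) (l 0) = k := fun k => by rw [hl]; simp
  have hk' : A ≤ k := by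
    rw [← h0 k]
    linarith [hN j hj.2.1, dist_triangle4 p (l 0) (l k) (q j), dist_comm p (l 0),
      dist_comm (l 0) (l k), dist_comm (l k) (q j)]
  have h₁ : A ≤ gp (l 0) (l i) (l k) := by
    rw [gp_eq, h0, h0, hl]
    rcases abs_cases ((i : ℝ) - k) with h | h <;> linarith
  linarith [gp_base_le (l 0) p (l i) (l k), gp_right_le p (l i) (l k) (q j),
    dist_comm (l k) (q j)]

section Axes

variable {Γ : Type*} [Group Γ] {S : Finset Γ} [MetricSpace Γ]

theorem sameBoundaryPoint_iff (hd : ∀ g h : Γ, dist g h = wordDist S g h) {u v : ℕ → Γ} :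
    SameBoundaryPoint S u v ↔
      ∀ M : ℝ, ∃ N : ℕ, ∀ i ≥ N, ∀ j ≥ N, M ≤ gp 1 (u i) (v j) := by
  have h : (fun g h : Γ => (wordDist S g h : ℝ)) = dist := by
    ext g h; exact (hd g h).symm
  rw [SameBoundaryPoint, h, prod_atTop_atTop_eq, tendsto_atTop]
  simp only [eventually_atTop_prod_self']

theorem SameBoundaryPoint.trans {δ : ℝ} (hd : ∀ g h : Γ, dist g h = wordDist S g h)
    (h : FourPoint Γ δ) {u v w : ℕ → Γ} (huv : SameBoundaryPoint S u v)
    (hvw : SameBoundaryPoint S v w) : SameBoundaryPoint S u w := by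
  rw [sameBoundaryPoint_iff hd] at *
  intro M
  obtain ⟨N₁, h₁⟩ := huv (M + δ)
  obtain ⟨N₂, h₂⟩ := hvw (M + δ)
  refine ⟨max N₁ N₂, fun i hi j hj => ?_⟩
  rw [ge_iff_le, max_le_iff] at hi hj
  have := h.le (h₁ i hi.1 (max N₁ N₂) (le_max_left _ _))
    (h₂ (max N₁ N₂) (le_max_right _ _) j hj.2)
  linarith

theorem dist_of_mem_axisGeodesics (hd : ∀ g h : Γ, dist g h = wordDist S g h) {a : Γ}
    {l : ℤ → Γ} (hl : l ∈ axisGeodesics S a) (m n : ℤ) : dist (l m) (l n) = |(m : ℝ) - n| := by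
  rw [hd]
  exact_mod_cast congrArg (Int.cast : ℤ → ℝ) (hl.1 m n)

/-- A quasi-geodesic which is close to a geodesic, with matching orientation, has the same
endpoints. -/
theorem sameBoundaryPoint_of_near (hd : ∀ g h : Γ, dist g h = wordDist S g h) {l q : ℤ → Γ}
    {m : ℤ → ℤ} {B K C : ℝ} {n₀ : ℤ} (hK : 1 ≤ K) (hq : IsQuasiGeodesic K C q)
    (hl : ∀ i j : ℤ, dist (l i) (l j) = |(i : ℝ) - j|)
    (hm : ∀ n : ℤ, dist (q n) (l (m n)) ≤ B ∧ (n₀ ≤ n → 0 ≤ m n) ∧ (n ≤ -n₀ → m n ≤ 0)) :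
    SameBoundaryPoint S (fun n : ℕ => l n) (fun n : ℕ => q n) ∧
      SameBoundaryPoint S (fun n : ℕ => l (-n)) (fun n : ℕ => q (-n)) := by
  have hinf : ∀ R : ℝ, ∃ N : ℕ, ∀ n : ℤ, (N : ℝ) ≤ |(n : ℝ)| → R ≤ dist 1 (q n) := by
    intro R
    refine ⟨⌈K * (R + dist 1 (q 0) + C)⌉₊, fun n hn => ?_⟩
    have h₁ := hq.abs_le hK n 0
    rw [Int.cast_zero, sub_zero] at h₁
    have h₂ := le_of_mul_le_mul_left ((Nat.le_ceil _).trans (hn.trans h₁)) (by linarith)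
    linarith [dist_triangle (q n) 1 (q 0), dist_comm (q n) 1]
  simp only [sameBoundaryPoint_iff hd]
  constructor
  · refine exists_le_gp_of_ray (n₀ := n₀.toNat) (B := B) (fun i j => by rw [hl]; simp)
      (fun n hn => ?_) (fun R => ?_)
    · obtain ⟨h₁, h₂, -⟩ := hm n
      refine ⟨(m n).toNat, ?_⟩
      rwa [Int.toNat_of_nonneg (h₂ (by omega))]
    · obtain ⟨N, hN⟩ := hinf R
      exact ⟨N, fun n hn => hN n (by
        rw [Int.cast_natCast, abs_of_nonneg (by positivity)]; exact_mod_cast hn)⟩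
  · refine exists_le_gp_of_ray (n₀ := n₀.toNat) (B := B) (fun i j => ?_) (fun n hn => ?_)
      (fun R => ?_)
    · rw [hl, ← abs_neg]; push_cast; congr 1; ring
    · obtain ⟨h₁, -, h₂⟩ := hm (-n)
      refine ⟨(-m (-n)).toNat, ?_⟩
      rwa [Int.toNat_of_nonneg (by have := h₂ (by omega); omega), neg_neg]
    · obtain ⟨N, hN⟩ := hinf R
      exact ⟨N, fun n hn => hN (-n) (by
        rw [Int.cast_neg, abs_neg, Int.cast_natCast, abs_of_nonneg (by positivity)]
        exact_mod_cast hn)⟩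

/-- The image of a geodesic of `L_S(a)` under an automorphism `ψ` is uniformly close to a geodesic
of `L_S(ψ a)`. -/
theorem exists_axisGeodesic_near_map {δ : ℝ} (hδ : 0 ≤ δ) (h : FourPoint Γ δ)
    (hS : Subgroup.closure (S : Set Γ) = ⊤) (hd : ∀ g h : Γ, dist g h = wordDist S g h)
    (ψ : MulAut Γ) :
    ∃ B : ℝ, 0 ≤ B ∧ ∀ (a : Γ), ∀ l ∈ axisGeodesics S a, ∃ l' ∈ axisGeodesics S (ψ a),
      ∃ m : ℤ → ℤ, ∀ n, dist (ψ (l n)) (l' (m n)) ≤ B := by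
  have hY := isDiscreteGeodesicSpace_of_wordDist hS hd
  obtain ⟨Λ, hΛ, hψ⟩ := exists_isQIEmbedding_mulAut hS hd ψ
  obtain ⟨B, hB, n₀, H⟩ := h.exists_geodesic_near hδ hY (finite_closedBall_of_wordDist hS hd) hΛ
    le_rfl
  obtain ⟨c, hc⟩ := hψ.exists_le_gp hΛ le_rfl hδ h hY.isRoughlyGeodesic hY.isRoughlyGeodesic hδ h
  refine ⟨B, hB, fun a l hl => ?_⟩
  have hq : IsQuasiGeodesic Λ 0 (fun n => ψ (l n)) := fun m n => by
    rw [← dist_of_mem_axisGeodesics hd hl]; exact hψ _ _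
  obtain ⟨l', m, hl', hm⟩ := H _ hq
  obtain ⟨hplus, hminus⟩ := sameBoundaryPoint_of_near hd hΛ hq hl' hm
  -- An automorphism fixes the base point `1` and coarsely preserves products, so it acts on
  -- boundary convergence. The powers of `a` go to the powers of `ψ a`, which identifies the
  -- endpoints of `l'`.
  have hmap : ∀ {u v : ℕ → Γ}, SameBoundaryPoint S u v →
      SameBoundaryPoint S (fun n => ψ (u n)) (fun n => ψ (v n)) := by
    intro u v huv
    rw [sameBoundaryPoint_iff hd] at *
    intro M
    obtain ⟨N, hN⟩ := huv (Λ * (M + c))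
    refine ⟨N, fun i hi j hj => ?_⟩
    have h₁ := hc 1 (u i) (v j)
    rw [map_one] at h₁
    have h₂ : M + c ≤ gp 1 (u i) (v j) / Λ := by
      rw [le_div_iff₀ (by linarith), mul_comm]; exact hN i hi j hj
    linarith
  refine ⟨l', ⟨fun i j => ?_, hplus.trans hd h ?_, hminus.trans hd h ?_⟩, m, fun n => (hm n).1⟩
  · have := hl' i j
    rw [hd] at this
    exact_mod_cast this
  · simpa only [map_pow] using hmap hl.2.1
  · simpa only [map_pow, map_inv] using hmap hl.2.2

/-- An element of large translation length has infinite order and an axis, along which it translates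
by at least its translation length, up to a constant. -/
theorem exists_axisGeodesic {δ : ℝ} (hδ : 0 ≤ δ) (h : FourPoint Γ δ)
    (hS : Subgroup.closure (S : Set Γ) = ⊤) (hd : ∀ g h : Γ, dist g h = wordDist S g h) {b : Γ}
    (hb : 6 * δ + 5 ≤ translationLength S b) :
    ¬ IsOfFinOrder b ∧ ∃ l ∈ axisGeodesics S b, ∃ (m : ℤ → ℤ) (B : ℝ),
      (∀ n : ℤ, dist (b ^ n) (l (m n)) ≤ B) ∧
      ∀ k : ℕ, k * (translationLength S b - 6 * δ) - B ≤ |(m k : ℝ) - m 0| := by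
  have hY := isDiscreteGeodesicSpace_of_wordDist hS hd
  have hmul := dist_mul_left_of_wordDist hd
  -- An infimum of natural numbers is attained, which supplies the point of minimal displacement for
  -- `FourPoint.le_dist_iterate`.
  obtain ⟨g, hg⟩ : ∃ g : Γ, wordDist S g (b * g) = translationLength S b :=
    Nat.sInf_mem (Set.range_nonempty fun g : Γ => wordDist S g (b * g))
  have hgd : dist g (b * g) = translationLength S b := by rw [hd, hg]
  have hiter : ∀ k : ℕ, k * (translationLength S b - 6 * δ) ≤ dist g (b ^ k * g) := by
    intro k
    have := h.le_dist_iterate (T := fun z => b * z) hδ hY (Isometry.of_dist_eq (hmul b)) (y := g)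
      (fun z => by
        rw [hgd, hd]
        exact_mod_cast Nat.sInf_le (Set.mem_range_self (f := fun g : Γ => wordDist S g (b * g)) z))
      (by rw [hgd]; linarith) k
    rw [hgd] at this
    simpa only [mul_left_iterate] using this
  have hpow : ∀ k : ℕ, k * (translationLength S b - 6 * δ) - 2 * dist 1 g ≤ dist 1 (b ^ k) := by
    intro k
    have h₁ := hmul (b ^ k) 1 g
    rw [mul_one] at h₁
    linarith [hiter k, dist_triangle4 g 1 (b ^ k) (b ^ k * g), dist_comm g 1]
  have hpow' : ∀ k : ℕ, dist 1 (b ^ k) ≤ k * dist 1 b := by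
    intro k
    induction k with
    | zero => simp
    | succ k ih =>
      have h₁ := hmul (b ^ k) 1 b
      rw [mul_one, ← pow_succ] at h₁
      push_cast
      linarith [dist_triangle 1 (b ^ k) (b ^ (k + 1))]
  have hK : 1 ≤ max 1 (dist 1 b) := le_max_left _ _
  have hq' : ∀ (m : ℤ) (k : ℕ), (k : ℝ) / max 1 (dist 1 b) - 2 * dist 1 g ≤
      dist (b ^ m) (b ^ (m + k)) ∧
      dist (b ^ m) (b ^ (m + k)) ≤ max 1 (dist 1 b) * k + 2 * dist 1 g := by
    intro m k
    have h₁ := hmul (b ^ m) 1 (b ^ (k : ℤ))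
    rw [mul_one, ← zpow_add, zpow_natCast] at h₁
    rw [h₁]
    have hk : (0 : ℝ) ≤ k := by positivity
    constructor
    · have h₂ : (k : ℝ) / max 1 (dist 1 b) ≤ k := div_le_self hk hK
      nlinarith [hpow k]
    · have h₂ : (k : ℝ) * dist 1 b ≤ k * max 1 (dist 1 b) := by gcongr; exact le_max_right _ _
      linarith [hpow' k, dist_nonneg (x := 1) (y := g)]
  have hq : IsQuasiGeodesic (max 1 (dist 1 b)) (2 * dist 1 g) (fun n : ℤ => b ^ n) := by
    intro m n
    rcases le_total m n with hmn | hmn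
    · obtain ⟨k, rfl⟩ := Int.le.dest hmn
      have := hq' m k
      push_cast
      rwa [show (m : ℝ) - (m + k) = -k by ring, abs_neg, abs_of_nonneg (by positivity)]
    · obtain ⟨k, rfl⟩ := Int.le.dest hmn
      have := hq' n k
      push_cast
      rwa [dist_comm (b ^ (n + (k : ℤ))), show (n : ℝ) + k - n = k by ring,
        abs_of_nonneg (by positivity)]
  obtain ⟨B, hB, n₀, H⟩ := h.exists_geodesic_near hδ hY (finite_closedBall_of_wordDist hS hd) hK
    (by positivity : 0 ≤ 2 * dist 1 g)
  obtain ⟨l, m, hl, hm⟩ := H _ hq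
  obtain ⟨hplus, hminus⟩ := sameBoundaryPoint_of_near hd hK hq hl hm
  -- The constant depends on `b` through `g`; this is harmless, as only the rate of progress in `k`
  -- matters.
  refine ⟨fun hfin => ?_, l, ⟨fun i j => ?_, ?_, ?_⟩, m, 2 * B + 2 * dist 1 g,
    fun n => (hm n).1.trans (by linarith [dist_nonneg (x := 1) (y := g)]), fun k => ?_⟩
  · obtain ⟨k, hk, hbk⟩ := isOfFinOrder_iff_pow_eq_one.1 hfin
    have h₁ := hiter k
    rw [hbk, one_mul, dist_self] at h₁
    have : (1 : ℝ) ≤ k := by exact_mod_cast hk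
    nlinarith
  · have := hl i j
    rw [hd] at this
    exact_mod_cast this
  · simpa only [zpow_natCast] using hplus
  · simpa only [zpow_neg, zpow_natCast, inv_pow] using hminus
  · rw [← hl]
    have h₁ := (hm k).1
    have h₂ := (hm 0).1
    have h₃ := hpow k
    have h₄ := dist_triangle4 (b ^ (0 : ℤ)) (l (m 0)) (l (m k)) (b ^ (k : ℤ))
    rw [zpow_zero, zpow_natCast] at h₄
    rw [zpow_natCast] at h₁
    rw [zpow_zero] at h₂
    linarith [dist_comm (l (m 0)) (l (m k)), dist_comm (b ^ k) (l (m k))]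

end Axes

/-! ## Orbits of representations -/

section Orbits

variable {Γ : Type*} [Group Γ] {S : Finset Γ} {X : Type*} [MetricSpace X]

theorem hom_mul_apply (ρ : RepSpace S X) (g h : Γ) (x : X) :
    ρ.hom (g * h) x = ρ.hom g (ρ.hom h x) := by
  rw [map_mul]; rfl

theorem dist_orbitMap_mul (ρ : RepSpace S X) (x : X) (k g h : Γ) :
    dist (orbitMap ρ x (k * g)) (orbitMap ρ x (k * h)) =
      dist (orbitMap ρ x g) (orbitMap ρ x h) := by
  simp only [orbitMap, hom_mul_apply]
  exact (ρ.hom k).isometry.dist_eq _ _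

theorem dist_orbitMap (ρ : RepSpace S X) (x : X) (g h : Γ) :
    dist (orbitMap ρ x g) (orbitMap ρ x h) = dist (ρ.hom (g⁻¹ * h) x) x := by
  have := dist_orbitMap_mul ρ x g⁻¹ g h
  rw [inv_mul_cancel] at this
  rw [← this, dist_comm]
  simp [orbitMap]

/-- Representations vary continuously, for pointwise convergence on `X`. -/
theorem continuous_hom_apply (hS : Subgroup.closure (S : Set Γ) = ⊤) (γ : Γ) :
    ∀ x : X, Continuous fun ρ : RepSpace S X => ρ.hom γ x := by
  have hγ : γ ∈ Subgroup.closure (S : Set Γ) := by rw [hS]; trivial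
  induction hγ using Subgroup.closure_induction with
  | mem s hs =>
    intro x
    have h₁ : Continuous fun ρ : RepSpace S X => ρ.hom s :=
      (continuous_apply (⟨s, hs⟩ : S)).comp
        (continuous_induced_dom (f := fun (ρ : RepSpace S X) (s : S) => ρ.hom s))
    have h₂ : Continuous fun g : X ≃ᵢ X => (⟨g, g.continuous⟩ : C(X, X)) := continuous_induced_dom
    exact (continuous_eval_const (F := C(X, X)) x).comp (h₂.comp h₁)
  | one => intro x; simpa using continuous_const
  | mul g h _ _ hg hh =>
    intro x
    refine continuous_iff_continuousAt.2 fun ρ₀ => tendsto_iff_dist_tendsto_zero.2 ?_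
    have h₁ := tendsto_iff_dist_tendsto_zero.1 ((hh x).tendsto ρ₀)
    have h₂ := tendsto_iff_dist_tendsto_zero.1 ((hg (ρ₀.hom h x)).tendsto ρ₀)
    have h₃ := h₁.add h₂
    rw [add_zero] at h₃
    refine squeeze_zero (fun _ => dist_nonneg) (fun ρ => ?_) h₃
    simp only [hom_mul_apply]
    rw [← (ρ.hom g).isometry.dist_eq (ρ.hom h x)]
    exact dist_triangle _ _ _
  -- Applying the isometry `ρ(g)` turns the distance between `ρ(g⁻¹)x` and `ρ₀(g⁻¹)x` into the
  -- distance between `x` and `ρ(g)ρ₀(g⁻¹)x`, where only `ρ(g)` varies.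
  | inv g _ hg =>
    intro x
    refine continuous_iff_continuousAt.2 fun ρ₀ => tendsto_iff_dist_tendsto_zero.2 ?_
    have h₁ := tendsto_iff_dist_tendsto_zero.1 ((hg (ρ₀.hom g⁻¹ x)).tendsto ρ₀)
    refine h₁.congr fun ρ => ?_
    rw [← hom_mul_apply ρ₀, mul_inv_cancel, map_one, ← (ρ.hom g).isometry.dist_eq (ρ.hom g⁻¹ x),
      ← hom_mul_apply ρ g g⁻¹, mul_inv_cancel, map_one, dist_comm]

theorem exists_conj_of_conjClass_eq {ρ σ : RepSpace S X}
    (h : conjClass S X ρ = conjClass S X σ) :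
    ∃ g : X ≃ᵢ X, ∀ (γ : Γ) (x : X), σ.hom γ (g x) = g (ρ.hom γ x) := by
  obtain ⟨g, hg⟩ := Quotient.exact h
  refine ⟨g, fun γ x => ?_⟩
  rw [hg]
  change g (ρ.hom γ (g⁻¹ (g x))) = _
  rw [IsometryEquiv.inv_apply_self]

theorem isOpen_image_conjClass {O : Set (RepSpace S X)} (hO : IsOpen O)
    (hsat : ∀ ρ ∈ O, ∀ σ, conjClass S X ρ = conjClass S X σ → σ ∈ O) :
    IsOpen (conjClass S X '' O) := by
  have h : conjClass S X ⁻¹' (conjClass S X '' O) = O := by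
    ext σ
    exact ⟨fun ⟨ρ, hρ, h⟩ => hsat ρ hρ σ h, fun hσ => ⟨σ, hσ, rfl⟩⟩
  have : IsOpen (conjClass S X ⁻¹' (conjClass S X '' O)) := by rwa [h]
  exact this

/-! ## Stability -/

theorem IsQuasiGeodesic.mono {K C K' C' : ℝ} {f : ℤ → X} (hf : IsQuasiGeodesic K C f)
    (hK0 : 1 ≤ K) (hK : K ≤ K') (hC : C ≤ C') : IsQuasiGeodesic K' C' f := by
  intro m n
  obtain ⟨h₁, h₂⟩ := hf m n
  constructor
  · have : |(m : ℝ) - n| / K' ≤ |(m : ℝ) - n| / K := by gcongr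
    linarith
  · have : K * |(m : ℝ) - n| ≤ K' * |(m : ℝ) - n| := by gcongr
    linarith

theorem IsStableWith.mono {A : Set Γ} {K C K' C' : ℝ} {ρ : RepSpace S X}
    (hρ : IsStableWith A K C ρ) (hK0 : 1 ≤ K) (hK : K ≤ K') (hC : C ≤ C') :
    IsStableWith A K' C' ρ := by
  obtain ⟨x, hx⟩ := hρ
  exact ⟨x, fun l hl => (hx l hl).mono hK0 hK hC⟩

theorem IsStableWith.conj {A : Set Γ} {K C : ℝ} {ρ σ : RepSpace S X}
    (hρ : IsStableWith A K C ρ) (h : conjClass S X ρ = conjClass S X σ) :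
    IsStableWith A K C σ := by
  obtain ⟨g, hg⟩ := exists_conj_of_conjClass_eq h
  obtain ⟨x, hx⟩ := hρ
  refine ⟨g x, fun l hl m n => ?_⟩
  have := hx l hl m n
  simpa only [orbitMap, hg, g.isometry.dist_eq] using this

/-- Stability, with uniform constants, holds in a neighbourhood of a stable class. -/
theorem IsStable.exists_nhd (hS : Subgroup.closure (S : Set Γ) = ⊤) (hXgeod : IsGeodesicSpace X)
    (hXhyp : IsGromovHyperbolic (fun x y : X => dist x y)) {A : Set Γ} {ρ₀ : RepSpace S X}
    (h₀ : IsStable A ρ₀) :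
    ∃ K C : ℝ, 1 ≤ K ∧ 0 ≤ C ∧ ∃ U : Set (CharSpace S X), IsOpen U ∧ conjClass S X ρ₀ ∈ U ∧
      ∀ ρ, conjClass S X ρ ∈ U → IsStableWith A K C ρ := by
  obtain ⟨δ, hδ, hX⟩ := hXhyp
  obtain ⟨K, C, hK, hC, x, hx⟩ := h₀
  obtain ⟨L, K', C', hK', hC', hloc⟩ := FourPoint.exists_isQuasiGeodesic_of_local hδ.le hX
    hXgeod.isRoughlyGeodesic hK (by positivity : 0 ≤ C + 1)
  set F := {γ | wordDist S 1 γ ≤ L}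
  have hF : F.Finite := finite_wordDist_le hS 1 L
  -- Allowing every base point `y` makes `O` invariant under conjugation, so that its image in the
  -- quotient is open. The tolerance `1` is the reason for `C + 1` in the local test.
  set O : Set (RepSpace S X) :=
    ⋃ y, ⋂ γ ∈ F, {ρ | |dist (ρ.hom γ y) y - dist (ρ₀.hom γ x) x| < 1}
  have hmemO : ∀ ρ, ρ ∈ O ↔
      ∃ y, ∀ γ ∈ F, |dist (ρ.hom γ y) y - dist (ρ₀.hom γ x) x| < 1 := by
    intro ρ; simp [O]
  have hO : IsOpen O := isOpen_iUnion fun y => hF.isOpen_biInter fun γ _ =>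
    isOpen_lt ((((continuous_hom_apply hS γ y).dist continuous_const).sub
      continuous_const).abs) continuous_const
  have hsat : ∀ ρ ∈ O, ∀ σ, conjClass S X ρ = conjClass S X σ → σ ∈ O := by
    intro ρ hρ σ h
    obtain ⟨g, hg⟩ := exists_conj_of_conjClass_eq h
    obtain ⟨y, hy⟩ := (hmemO ρ).1 hρ
    refine (hmemO σ).2 ⟨g y, fun γ hγ => ?_⟩
    rw [hg, g.isometry.dist_eq]
    exact hy γ hγ
  have hstab : ∀ ρ ∈ O, IsStableWith A K' C' ρ := by
    intro ρ hρ
    obtain ⟨y, hy⟩ := (hmemO ρ).1 hρ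
    refine ⟨y, fun l hl => hloc _ fun m n hmn => ?_⟩
    have h₁ := hx l hl m n
    obtain ⟨a, -, -, hla⟩ := hl
    have hF' : (l m)⁻¹ * l n ∈ F := by
      have h₂ := wordDist_mul_left S (l m)⁻¹ (l m) (l n)
      rw [inv_mul_cancel] at h₂
      have h₃ := hla.1 m n
      change wordDist S 1 ((l m)⁻¹ * l n) ≤ L
      rw [h₂]
      omega
    have h₂ := abs_lt.1 (hy _ hF')
    simp only [dist_orbitMap] at h₁ ⊢
    constructor <;> linarith
  refine ⟨K', C', hK', hC', conjClass S X '' O, isOpen_image_conjClass hO hsat,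
    ⟨ρ₀, (hmemO ρ₀).2 ⟨x, fun γ _ => by simp⟩, rfl⟩, ?_⟩
  rintro ρ ⟨σ, hσ, h⟩
  exact (hstab σ hσ).conj h

/-- Stability is invariant under automorphisms. -/
theorem IsStable.smul (hΓ : IsHyperbolicGroup Γ) (hS : Subgroup.closure (S : Set Γ) = ⊤)
    {A : Set Γ} (hA : IsAutInvariant A) {ρ : RepSpace S X} (hρ : IsStable A ρ) (φ : MulAut Γ) :
    IsStable A (φ • ρ) := by
  let _ := wordMetric S hS
  have hd : ∀ g h : Γ, dist g h = wordDist S g h := fun _ _ => rfl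
  obtain ⟨δ, hδ, hyp⟩ := hΓ.exists_fourPoint hS
  obtain ⟨K, C, hK, hC, x, hx⟩ := hρ
  -- The orbit of `x` under `φ • ρ` along `l` is the orbit under `ρ` along `φ⁻¹(l)`, which is close
  -- to a geodesic of `L_S(φ⁻¹ a)`; the same base point works.
  obtain ⟨B, hB, hmap⟩ := exists_axisGeodesic_near_map hδ hyp hS hd φ⁻¹
  obtain ⟨Λ₁, hΛ₁, hψ⟩ := exists_isQIEmbedding_mulAut hS hd φ⁻¹
  obtain ⟨Λ, hΛ, horb⟩ := exists_dist_le_mul_wordDist hS (orbitMap ρ x) (dist_orbitMap_mul ρ x)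
  simp only [← hd] at horb
  refine ⟨max (Λ₁ * K) (Λ * Λ₁), 2 * B + C + 2 * (Λ * B), ?_, by positivity, x, ?_⟩
  · exact le_max_of_le_left (one_le_mul_of_one_le_of_one_le hΛ₁ hK)
  rintro l ⟨a, haA, hafin, hl⟩ m n
  obtain ⟨l', hl', μ, hμ⟩ := hmap a l hl
  have hl'A : l' ∈ geodesicsOf S A := by
    refine ⟨φ⁻¹ a, hA _ a haA, fun hfin => hafin ?_, hl'⟩
    have := MonoidHom.isOfFinOrder (φ : MulAut Γ).toMonoidHom hfin
    simpa using this
  have h₁ := (hx l' hl'A (μ m) (μ n)).1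
  change |(m : ℝ) - n| / _ - _ ≤ dist (orbitMap ρ x (φ⁻¹ (l m))) (orbitMap ρ x (φ⁻¹ (l n))) ∧
    dist (orbitMap ρ x (φ⁻¹ (l m))) (orbitMap ρ x (φ⁻¹ (l n))) ≤ _
  have h₂ := hψ (l m) (l n)
  rw [dist_of_mem_axisGeodesics hd hl, sub_zero, add_zero] at h₂
  have h₃ : ∀ k, dist (orbitMap ρ x (φ⁻¹ (l k))) (orbitMap ρ x (l' (μ k))) ≤ Λ * B := fun k =>
    (horb _ _).trans (by gcongr; exact hμ k)
  have hΛ₁0 : 0 < Λ₁ := by linarith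
  have hK0 : 0 < K := by linarith
  constructor
  · have h₄ : |(m : ℝ) - n| / Λ₁ - 2 * B ≤ |(μ m : ℝ) - μ n| := by
      rw [← dist_of_mem_axisGeodesics hd hl' (μ m) (μ n)]
      linarith [hμ m, hμ n, dist_triangle4 (φ⁻¹ (l m)) (l' (μ m)) (l' (μ n)) (φ⁻¹ (l n)),
        dist_comm (φ⁻¹ (l n)) (l' (μ n))]
    have h₅ : (|(m : ℝ) - n| / Λ₁ - 2 * B) / K ≤ |(μ m : ℝ) - μ n| / K := by gcongr
    rw [sub_div, div_div] at h₅
    have h₆ : 2 * B / K ≤ 2 * B := div_le_self (by positivity) hK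
    have h₇ : |(m : ℝ) - n| / max (Λ₁ * K) (Λ * Λ₁) ≤ |(m : ℝ) - n| / (Λ₁ * K) := by
      gcongr; exact le_max_left _ _
    linarith [h₃ m, h₃ n, dist_triangle4 (orbitMap ρ x (l' (μ m))) (orbitMap ρ x (φ⁻¹ (l m)))
      (orbitMap ρ x (φ⁻¹ (l n))) (orbitMap ρ x (l' (μ n))),
      dist_comm (orbitMap ρ x (l' (μ m))) (orbitMap ρ x (φ⁻¹ (l m)))]
  · refine (horb _ _).trans ?_
    have h₄ : Λ * dist (φ⁻¹ (l m)) (φ⁻¹ (l n)) ≤ Λ * (Λ₁ * |(m : ℝ) - n|) := by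
      gcongr; exact h₂.2
    have h₅ : Λ * Λ₁ * |(m : ℝ) - n| ≤ max (Λ₁ * K) (Λ * Λ₁) * |(m : ℝ) - n| := by
      gcongr; exact le_max_right _ _
    have : 0 ≤ 2 * B + C + 2 * (Λ * B) := by positivity
    linarith

/-- Displacements under a stable representation are bounded below by the translation lengths of
elements of `A`. -/
theorem IsStableWith.le_dist [MetricSpace Γ] {δ : ℝ} (hδ : 0 ≤ δ) (hyp : FourPoint Γ δ)
    (hS : Subgroup.closure (S : Set Γ) = ⊤) (hd : ∀ g h : Γ, dist g h = wordDist S g h)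
    {A : Set Γ} {K C : ℝ} (hK : 1 ≤ K) {ρ : RepSpace S X} (hρ : IsStableWith A K C ρ)
    {b : Γ} (hbA : b ∈ A) (hb : 6 * δ + 5 ≤ translationLength S b) (y : X) :
    translationLength S b - 6 * δ ≤ K * dist (ρ.hom b y) y := by
  obtain ⟨x, hx⟩ := hρ
  obtain ⟨hfin, l, hl, m, B, hm, hprog⟩ := exists_axisGeodesic hδ hyp hS hd hb
  obtain ⟨Λ, hΛ, horb⟩ := exists_dist_le_mul_wordDist hS (orbitMap ρ x) (dist_orbitMap_mul ρ x)
  simp only [← hd] at horb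
  set τ := dist (ρ.hom b y) y
  have hpow : ∀ k : ℕ, dist (ρ.hom (b ^ k) y) y ≤ k * τ := by
    intro k
    induction k with
    | zero => simp
    | succ k ih =>
      rw [pow_succ, hom_mul_apply]
      have h₁ := (ρ.hom (b ^ k)).isometry.dist_eq (ρ.hom b y) y
      push_cast
      linarith [dist_triangle (ρ.hom (b ^ k) (ρ.hom b y)) (ρ.hom (b ^ k) y) y]
  have hK0 : 0 < K := by linarith
  -- The right-hand side does not depend on `k`, so the coefficient of `k` on the left cannot be
  -- positive.
  have hbound : ∀ k : ℕ, k * (translationLength S b - 6 * δ - K * τ) ≤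
      B + K * (C + 2 * (Λ * B) + 2 * dist x y) := by
    intro k
    have h₁ := (hx l ⟨b, hbA, hfin, hl⟩ (m k) (m 0)).1
    have h₂ := hprog k
    have h₃ : ∀ n : ℤ, dist (orbitMap ρ x (b ^ n)) (orbitMap ρ x (l (m n))) ≤ Λ * B := fun n =>
      (horb _ _).trans (by gcongr; exact hm n)
    have h₄ := h₃ k
    have h₅ := h₃ 0
    rw [zpow_natCast] at h₄
    rw [zpow_zero] at h₅
    have h₆ : dist (orbitMap ρ x (b ^ k)) (orbitMap ρ x 1) ≤ k * τ + 2 * dist x y := by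
      have h₇ := (ρ.hom (b ^ k)).isometry.dist_eq x y
      have h₈ : orbitMap ρ x 1 = x := by simp [orbitMap]
      rw [h₈]
      change dist (ρ.hom (b ^ k) x) x ≤ _
      linarith [dist_triangle4 (ρ.hom (b ^ k) x) (ρ.hom (b ^ k) y) y x, dist_comm x y, hpow k]
    have h₇ : |(m k : ℝ) - m 0| / K ≤ k * τ + (C + 2 * (Λ * B) + 2 * dist x y) := by
      linarith [dist_triangle4 (orbitMap ρ x (l (m k))) (orbitMap ρ x (b ^ k)) (orbitMap ρ x 1)
        (orbitMap ρ x (l (m 0))), dist_comm (orbitMap ρ x (l (m k))) (orbitMap ρ x (b ^ k))]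
    rw [div_le_iff₀ hK0] at h₇
    linarith
  by_contra! hlt
  have hpos : 0 < translationLength S b - 6 * δ - K * τ := by linarith
  obtain ⟨k, hk⟩ := exists_nat_gt ((B + K * (C + 2 * (Λ * B) + 2 * dist x y)) /
    (translationLength S b - 6 * δ - K * τ))
  rw [div_lt_iff₀ hpos] at hk
  linarith [hbound k]

/-! ## Proper discontinuity -/

theorem isOpen_stableClasses (hS : Subgroup.closure (S : Set Γ) = ⊤)
    (hXgeod : IsGeodesicSpace X) (hXhyp : IsGromovHyperbolic (fun x y : X => dist x y))
    (A : Set Γ) : IsOpen (stableClasses S X A) := by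
  refine isOpen_iff_forall_mem_open.2 ?_
  rintro _ ⟨ρ₀, h₀, rfl⟩
  obtain ⟨K, C, hK, hC, U, hU, hmem, hstab⟩ := IsStable.exists_nhd hS hXgeod hXhyp h₀
  refine ⟨U, fun c hc => ?_, hU, hmem⟩
  obtain ⟨ρ, rfl⟩ := Quotient.exists_rep c
  exact ⟨ρ, ⟨K, C, hK, hC, hstab ρ hc⟩, rfl⟩

/-- The constants of stability are uniform over compact sets of stable classes. -/
theorem exists_isStableWith_of_isCompact (hS : Subgroup.closure (S : Set Γ) = ⊤)
    (hXgeod : IsGeodesicSpace X) (hXhyp : IsGromovHyperbolic (fun x y : X => dist x y))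
    {A : Set Γ} {R : Set (CharSpace S X)} (hR : R ⊆ stableClasses S X A) (hRc : IsCompact R) :
    ∃ K C : ℝ, 1 ≤ K ∧ ∀ ρ, conjClass S X ρ ∈ R → IsStableWith A K C ρ := by
  refine hRc.induction_on (p := fun s => ∃ K C : ℝ, 1 ≤ K ∧
    ∀ ρ, conjClass S X ρ ∈ s → IsStableWith A K C ρ) ⟨1, 0, le_rfl, fun ρ h => h.elim⟩ ?_ ?_ ?_
  · rintro s t hst ⟨K, C, hK, h⟩
    exact ⟨K, C, hK, fun ρ hρ => h ρ (hst hρ)⟩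
  · rintro s t ⟨K₁, C₁, hK₁, h₁⟩ ⟨K₂, C₂, hK₂, h₂⟩
    refine ⟨max K₁ K₂, max C₁ C₂, le_max_of_le_left hK₁, fun ρ hρ => ?_⟩
    rcases hρ with hρ | hρ
    · exact (h₁ ρ hρ).mono hK₁ (le_max_left _ _) (le_max_left _ _)
    · exact (h₂ ρ hρ).mono hK₂ (le_max_right _ _) (le_max_right _ _)
  · intro c hc
    obtain ⟨ρ₀, h₀, rfl⟩ := hR hc
    obtain ⟨K, C, hK, -, U, hU, hmem, hstab⟩ := IsStable.exists_nhd hS hXgeod hXhyp h₀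
    exact ⟨U, mem_nhdsWithin_of_mem_nhds (hU.mem_nhds hmem), K, C, hK, hstab⟩

/-- The minimal displacement of a given element is bounded over compact sets of classes. -/
theorem exists_dist_le_of_isCompact [Nonempty X] (hS : Subgroup.closure (S : Set Γ) = ⊤)
    {R : Set (CharSpace S X)} (hRc : IsCompact R) (a : Γ) :
    ∃ M : ℝ, ∀ ρ, conjClass S X ρ ∈ R → ∃ x, dist (ρ.hom a x) x ≤ M := by
  refine hRc.induction_on (p := fun s => ∃ M : ℝ, ∀ ρ, conjClass S X ρ ∈ s →
    ∃ x, dist (ρ.hom a x) x ≤ M) ⟨0, fun ρ h => h.elim⟩ ?_ ?_ ?_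
  · rintro s t hst ⟨M, h⟩
    exact ⟨M, fun ρ hρ => h ρ (hst hρ)⟩
  · rintro s t ⟨M₁, h₁⟩ ⟨M₂, h₂⟩
    refine ⟨max M₁ M₂, fun ρ hρ => ?_⟩
    rcases hρ with hρ | hρ
    · obtain ⟨x, hx⟩ := h₁ ρ hρ
      exact ⟨x, le_max_of_le_left hx⟩
    · obtain ⟨x, hx⟩ := h₂ ρ hρ
      exact ⟨x, le_max_of_le_right hx⟩
  · intro c hc
    obtain ⟨ρ₀, rfl⟩ := Quotient.exists_rep c
    obtain ⟨x₀⟩ := ‹Nonempty X›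
    set M := dist (ρ₀.hom a x₀) x₀ + 1
    set O : Set (RepSpace S X) := ⋃ x, {ρ | dist (ρ.hom a x) x < M}
    have hmemO : ∀ ρ, ρ ∈ O ↔ ∃ x, dist (ρ.hom a x) x < M := by intro ρ; simp [O]
    have hO : IsOpen O := isOpen_iUnion fun x =>
      isOpen_lt ((continuous_hom_apply hS a x).dist continuous_const) continuous_const
    have hsat : ∀ ρ ∈ O, ∀ σ, conjClass S X ρ = conjClass S X σ → σ ∈ O := by
      intro ρ hρ σ h
      obtain ⟨g, hg⟩ := exists_conj_of_conjClass_eq h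
      obtain ⟨x, hx⟩ := (hmemO ρ).1 hρ
      refine (hmemO σ).2 ⟨g x, ?_⟩
      rwa [hg, g.isometry.dist_eq]
    refine ⟨conjClass S X '' O, mem_nhdsWithin_of_mem_nhds
      ((isOpen_image_conjClass hO hsat).mem_nhds
        ⟨ρ₀, (hmemO ρ₀).2 ⟨x₀, lt_add_one _⟩, rfl⟩), M, ?_⟩
    rintro ρ ⟨σ, hσ, h⟩
    obtain ⟨x, hx⟩ := (hmemO ρ).1 (hsat σ hσ ρ h)
    exact ⟨x, hx.le⟩

theorem actsProperlyDiscontinuouslyOn_stableClasses (hΓ : IsHyperbolicGroup Γ)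
    (hS : Subgroup.closure (S : Set Γ) = ⊤) (hXgeod : IsGeodesicSpace X)
    (hXhyp : IsGromovHyperbolic (fun x y : X => dist x y)) {A : Set Γ} (hA : IsAutInvariant A)
    (hAtest : IsTestSubset S A) :
    ActsProperlyDiscontinuouslyOn (Out Γ) (stableClasses S X A) := by
  intro R hR hRc
  by_contra hinf
  rcases R.eq_empty_or_nonempty with rfl | ⟨c₀, hc₀⟩
  · simp at hinf
  -- A stable class carries a base point, so `X` is nonempty.
  obtain ⟨ρ₀, ⟨_, _, _, _, x₀, _⟩, -⟩ := hR hc₀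
  have : Nonempty X := ⟨x₀⟩
  let _ := wordMetric S hS
  have hd : ∀ g h : Γ, dist g h = wordDist S g h := fun _ _ => rfl
  obtain ⟨δ, hδ, hyp⟩ := hΓ.exists_fourPoint hS
  obtain ⟨K, C, hK, hstab⟩ := exists_isStableWith_of_isCompact hS hXgeod hXhyp hR hRc
  set φ := Set.Infinite.natEmbedding _ hinf
  obtain ⟨a, haA, ha⟩ := hAtest (fun n => (φ n : Out Γ))
    (Subtype.val_injective.comp φ.injective)
  obtain ⟨M, hM⟩ := exists_dist_le_of_isCompact hS hRc a
  -- The stability of `ψ • ρ` is applied to the element `ψ a` of `A`, whose displacement under `ψ •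
  -- ρ` is that of `a` under `ρ`. The bound is uniform in `n` because both classes lie in `R`.
  have hbound : ∀ n, outTranslationLength S (φ n : Out Γ) a ≤
      ⌈max (6 * δ + 5) (K * M + 6 * δ)⌉₊ := by
    intro n
    obtain ⟨c, ⟨c', hc', rfl⟩, hc⟩ := (φ n).2
    generalize (φ n : Out Γ) = f at hc
    obtain ⟨ψ, rfl⟩ := QuotientGroup.mk_surjective f
    obtain ⟨ρ, rfl⟩ := Quotient.exists_rep c'
    change translationLength S (ψ a) ≤ _
    have hst : IsStableWith A K C (ψ • ρ) := hstab (ψ • ρ) hc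
    obtain ⟨x, hx⟩ := hM ρ hc'
    have hle : (translationLength S (ψ a) : ℝ) ≤ max (6 * δ + 5) (K * M + 6 * δ) := by
      by_contra! hlt
      obtain ⟨h₁, h₂⟩ := max_lt_iff.1 hlt
      have h₃ := hst.le_dist hδ hyp hS hd hK (hA ψ a haA) h₁.le x
      have h₄ : (ψ • ρ).hom (ψ a) = ρ.hom a := congrArg ρ.hom (ψ.symm_apply_apply a)
      rw [h₄] at h₃
      have : K * dist (ρ.hom a x) x ≤ K * M := by gcongr
      linarith
    exact_mod_cast hle.trans (Nat.le_ceil _)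
  have hlim : limsup (fun n => (outTranslationLength S (φ n : Out Γ) a : ℕ∞)) atTop ≤
      ⌈max (6 * δ + 5) (K * M + 6 * δ)⌉₊ :=
    limsup_le_of_le (h := Eventually.of_forall fun n => by exact_mod_cast hbound n)
  rw [ha] at hlim
  exact ENat.natCast_ne_top _ (top_le_iff.1 hlim)

end Orbits

end AStable

end

open AStable

theorem theorem1p5 {Γ : Type*} [Group Γ] (hΓ : IsHyperbolicGroup Γ)
    (S : Finset Γ) (hS : Subgroup.closure (S : Set Γ) = ⊤)
    (X : Type*) [MetricSpace X] [ProperSpace X] (hXgeod : IsGeodesicSpace X)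
    (hXhyp : IsGromovHyperbolic (fun x y : X => dist x y))
    (A : Set Γ) (hA : IsAutInvariant A) (hAtest : IsTestSubset S A) :
    IsOpenSetOfDiscontinuity (Out Γ) (stableClasses S X A) where
  isOpen := isOpen_stableClasses hS hXgeod hXhyp A
  smul_mem := by
    rintro f _ ⟨ρ, hρ, rfl⟩
    obtain ⟨φ, rfl⟩ := QuotientGroup.mk_surjective f
    exact ⟨φ • ρ, IsStable.smul hΓ hS hA hρ φ, rfl⟩
  properlyDiscontinuous :=
    actsProperlyDiscontinuouslyOn_stableClasses hΓ hS hXgeod hXhyp hA hAtest
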